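/- Let $G$ be a finite connected multigraph without loops, with vertex set $V(G)$ and edge set $E(G)$, equipped with a ribbon structure, i.e. a cyclic ordering of the edges around each vertex. Let $S(G)$ be the set of spanning trees of $G$ and let $g=\#E(G)-\#V(G)+1$. A divisor is an element of the free abelian group on $V(G)$; its degree is the sum of its coefficients. Two divisors are linearly equivalent if they differ by $\Delta f=\sum_{v}\big(\sum_{e=vw}(f(v)-f(w))\big)(v)$ for some $f:V(G)\to\mathbb Z$. Let $\operatorname{Pic}^d(G)$ be the set of linear equivalence classes $[D]$ of divisors $D$ of degree $d$; the group $\operatorname{Pic}^0(G)$ acts on $\operatorname{Pic}^d(G)$ by addition. A break divisor is a divisor of the form $\sum_{f\in E(G)\setminus T}(v_f)$, where $T\in S(G)$ and $v_f$ is an end of $f$; let $B(G)$ be the set of break divisors. For a vertex $v$, an edge $e$ incident to $v$ and a spanning tree $T$, the Bernardi tour starts at $v$ facing $e$ and is continued as follows: when standing at a vertex $x$ and facing an edge $f$, if $f\in T$, walk along $f$ to its other end $y$ and face the edge that follows $f$ in the cyclic order around $y$; if $f\notin T$, cut through $f$, i.e. stay at $x$ and face the edge that follows $f$ in the cyclic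 order around $x$. Put $\beta_{(v,e)}(T)=\sum_{f\notin T}(\eta(f))$, where $\eta(f)$ is the vertex at which the tour stands when it cuts through $f$ for the first time. Fix a vertex $v$ of $G$. Then $D\mapsto[D]$ is a bijection $B(G)\to\operatorname{Pic}^g(G)$, and for every edge $e$ incident to $v$ the map $\beta_{(v,e)}$ is a bijection $S(G)\to B(G)$. For $\gamma\in\operatorname{Pic}^0(G)$ and $D\in B(G)$, let $\gamma\cdot D$ be the unique break divisor with $[\gamma\cdot D]=\gamma+[D]$. Moreover: 1. For all edges $e_1,e_2$ incident to $v$ there is $\gamma_0\in\operatorname{Pic}^0(G)$ such that $\beta_{(v,e_2)}(T)=\gamma_0\cdot\beta_{(v,e_1)}(T)$ for all $T\in S(G)$. 2. For $\gamma\in\operatorname{Pic}^0(G)$ and $T\in S(G)$, the spanning tree $\gamma\cdot T:=\beta_{(v,e)}^{-1}\big(\gamma\cdot\beta_{(v,e)}(T)\big)$ is the same for every edge $e$ incident to $v$. 3. The map $(\gamma,T)\mapsto\gamma\cdot T$ of part 2 is a simply transitive action of $\operatorname{Pic}^0(G)$ on $S(G)$, i.e. it makes $S(G)$ a torsor for $\operatorname{Pic}^0(G)$.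 (If $G$ has a single vertex, there is no edge at $v$; then $S(G)$ and $\operatorname{Pic}^0(G)$ have one element each, and the action is the trivial one.) -/

import Mathlib

open scoped Graph

namespace Bernardi

noncomputable section

open Classical in
/-- The divisor `(x)`, for a vertex `x`. For a finite graph the free abelian group on the vertices
is the group `V(G) → ℤ`. -/
def pointDiv {α β : Type*} {G : Graph α β} (x : V(G)) : V(G) → ℤ := Pi.single x 1

/-! ### Connectedness and spanning trees -/

/-- `x` and `y` are joined by a walk all of whose edges belong to `T`. -/
def Joined {α β : Type*} (G : Graph α β) (T : Set E(G)) : V(G) → V(G) → Prop :=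
  Relation.ReflTransGen fun x y => ∃ e ∈ T, G.IsLink e x y

/-- A graph is connected if it has a vertex and any two vertices are joined by a walk. -/
def IsConnected {α β : Type*} (G : Graph α β) : Prop :=
  Nonempty V(G) ∧ ∀ x y : V(G), Joined G Set.univ x y

/-- `T` is the edge set of a spanning tree: it joins any two vertices, and it contains no cycle,
that is, no edge of `T` has ends that are joined by a walk in the rest of `T`. -/
structure IsSpanningTree {α β : Type*} (G : Graph α β) (T : Set E(G)) : Prop where
  joined : ∀ x y : V(G), Joined G T x y
  acyclic : ∀ e ∈ T, ∀ x y : V(G), G.IsLink e x y → ¬ Joined G (T \ {e}) x y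

/-- The set `S(G)` of spanning trees of `G`. -/
abbrev SpanningTree {α β : Type*} (G : Graph α β) : Type _ :=
  {T : Set E(G) // IsSpanningTree G T}

/-! ### Half-edges and ribbon structures -/

/-- A half-edge: an edge together with one of its ends. In a loopless graph it is the same thing as
an edge directed away from `vertex`. -/
@[ext]
structure Dart {α β : Type*} (G : Graph α β) where
  vertex : V(G)
  edge : E(G)
  inc : G.Inc edge vertex

instance {α β : Type*} (G : Graph α β) [Fintype V(G)] [Fintype E(G)] : Fintype (Dart G) :=
  haveI : Finite (Dart G) := Finite.of_injective (fun d : Dart G => (d.vertex, d.edge)) <| by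
    intro a b h
    simp only [Prod.mk.injEq] at h
    exact Dart.ext h.1 h.2
  Fintype.ofFinite _

/-- The other half of the edge of a half-edge. -/
def Dart.opp {α β : Type*} {G : Graph α β} (d : Dart G) : Dart G where
  vertex := ⟨d.inc.other, d.inc.isLink_other.right_mem⟩
  edge := d.edge
  inc := d.inc.inc_other

/-- A ribbon structure: a cyclic ordering of the (half-)edges around each vertex, given by the
successor permutation `next`, whose orbits are exactly the sets of half-edges at a vertex. -/
structure RibbonStructure {α β : Type*} (G : Graph α β) where
  next : Equiv.Perm (Dart G)
  vertex_next : ∀ d, (next d).vertex = d.vertex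
  sameCycle : ∀ d d' : Dart G, d.vertex = d'.vertex → next.SameCycle d d'

/-- The edges incident to `v`. -/
abbrev EdgeAt {α β : Type*} (G : Graph α β) (v : V(G)) : Type _ := {e : E(G) // G.Inc e v}

/-! ### Divisors and linear equivalence -/

section Divisors

variable {α β : Type*} (G : Graph α β) [Fintype V(G)] [Fintype E(G)]

/-- The degree of a divisor. -/
def deg : (V(G) → ℤ) →+ ℤ where
  toFun D := ∑ x, D x
  map_zero' := by simp
  map_add' D D' := by simp [Finset.sum_add_distrib]

open Classical in
/-- The Laplacian: `(Δ f)(v) = ∑ (f(v) - f(w))`, summed over all edges `vw` at `v`. -/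
def laplacian : (V(G) → ℤ) →+ (V(G) → ℤ) where
  toFun f v := ∑ d : Dart G with d.vertex = v, (f v - f d.opp.vertex)
  map_zero' := by ext v; simp
  map_add' f f' := by
    ext v
    simp only [Pi.add_apply, ← Finset.sum_add_distrib]
    exact Finset.sum_congr rfl fun d _ => by ring

/-- The group of principal divisors. -/
def Prin : AddSubgroup (V(G) → ℤ) := (laplacian G).range

/-- The group of all divisors modulo linear equivalence. -/
abbrev Pic : Type _ := (V(G) → ℤ) ⧸ Prin G

/-- The linear equivalence class of a divisor. -/
def divClass : (V(G) → ℤ) →+ Pic G := QuotientAddGroup.mk' (Prin G)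

/-- `Pic^d(G)`: the set of linear equivalence classes of divisors of degree `d`. -/
def PicDeg (d : ℤ) : Set (Pic G) := {c | ∃ D, deg G D = d ∧ divClass G D = c}

/-- The group `Pic⁰(G)` of classes of divisors of degree `0`. -/
def PicZero : AddSubgroup (Pic G) := (deg G).ker.map (divClass G)

/-- The action of `Pic⁰(G)` on `Pic^d(G)` by addition. -/
instance (d : ℤ) : AddAction (PicZero G) (PicDeg G d) where
  vadd γ c := ⟨γ.1 + c.1, by
    obtain ⟨_, D₀, h₀, rfl⟩ := γ
    obtain ⟨_, D, h, rfl⟩ := c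
    have h₀' : deg G D₀ = 0 := h₀
    exact ⟨D₀ + D, by rw [map_add, h₀', h, zero_add], map_add _ _ _⟩⟩
  zero_vadd c := Subtype.ext (zero_add c.1)
  add_vadd γ γ' c := Subtype.ext (add_assoc γ.1 γ'.1 c.1)

/-- The combinatorial genus `#E(G) - #V(G) + 1`. -/
def genus : ℤ := (Fintype.card E(G) : ℤ) - (Fintype.card V(G) : ℤ) + 1

open Classical in
/-- `D` is a `T`-break divisor: a sum of one end of each edge outside `T`. -/
def IsBreakDivisorOf (T : Set E(G)) (D : V(G) → ℤ) : Prop :=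
  ∃ c : {e : E(G) // e ∉ T} → V(G), (∀ e, G.Inc e.1 (c e)) ∧ D = ∑ e, pointDiv (c e)

/-- The set `B(G)` of break divisors. -/
abbrev BreakDivisor : Type _ :=
  {D : V(G) → ℤ // ∃ T, IsSpanningTree G T ∧ IsBreakDivisorOf G T D}

variable {G}

/-- Given the identification `b : D ↦ [D]` of break divisors with `Pic^g(G)`, the action of
`Pic⁰(G)` on break divisors: `γ · D` is the break divisor whose class is `γ + [D]`. -/
def breakAct (b : BreakDivisor G ≃ PicDeg G (genus G)) (γ : PicZero G) (D : BreakDivisor G) :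
    BreakDivisor G :=
  b.symm (γ +ᵥ b D)

end Divisors

/-! ### The Bernardi process -/

section Tour

variable {α β : Type*} {G : Graph α β} (R : RibbonStructure G)

open Classical in
/-- One step of the tour of `T`. Standing at `d.vertex` and facing `d.edge`: if the edge belongs
to `T`, walk along it and face the next edge around the vertex reached; otherwise cut through it
and face the next edge around the same vertex. -/
def tourStep (T : Set E(G)) (d : Dart G) : Dart G :=
  if d.edge ∈ T then R.next d.opp else R.next d

/-- The `i`-th half-edge (`i = 0, 1, …`) met by the tour of `T` with initial data `(v, e)`. -/
def tour (v : V(G)) (e : EdgeAt G v) (T : Set E(G)) (i : ℕ) : Dart G :=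
  (tourStep R T)^[i] ⟨v, e.1, e.2⟩

/-- The vertex at which the tour stands when it first meets the edge `f`. (For a spanning tree `T`
every edge is met, so the set below is nonempty.) -/
def firstMeet (v : V(G)) (e : EdgeAt G v) (T : Set E(G)) (f : E(G)) : V(G) :=
  (tour R v e T (sInf {i | (tour R v e T i).edge = f})).vertex

open Classical in
/-- The divisor `β_(v,e)(T)`: each edge outside `T` contributes a chip at the vertex from which the
tour first cuts through it. -/
def bernardiDivisor [Fintype E(G)] (v : V(G)) (e : EdgeAt G v) (T : Set E(G)) : V(G) → ℤ :=
  ∑ f : {f : E(G) // f ∉ T}, pointDiv (firstMeet R v e T f.1)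

end Tour

end

end Bernardi

namespace Bernardi

variable {α β : Type*} {G : Graph α β}

/-! ### Half-edges -/

namespace Dart

/-! For a half-edge `d` write β_d for the Bernardi map whose tours start at `d`. One step of a tour
is a permutation of the half-edges. Adding an edge to a forest multiplies it by a transposition that
merges two cycles, so the tour of a tree is one cycle through all half-edges; moreover, after
crossing a tree edge it exhausts the far side before returning (`exists_iterate_side`).

β_d is injective: where the tours of two trees diverge, they face an edge of exactly one of the
trees, and the two divisors have different numbers of chips on its far side (`tourDivisor_ne`). It
is onto the break divisors: among all trees with chip placements that represent a given divisor, one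
with the lexicographically largest tour record places its chips as the Bernardi process does
(`exists_tourDivisor_eq`).

If `d` leads from x to y, turning `d` to the next half-edge changes β_d(T), up to linear
equivalence, by (y) - (x), whatever T is (`divClass_tourDivisor_next`). This has two uses. First, as
β_d is onto, the classes of break divisors are stable under translation by (y) - (x) for adjacent x
and y, hence under all of Pic⁰ by connectedness, so they fill Pic^g; that each class occurs once is
an edge count (`eq_of_divClass_eq`). Second, the maps β_d for the half-edges at one vertex differ by
translations. As Pic⁰ is commutative, these commute with its action, so all of them transport the
same simply transitive action from Pic^g to the trees. -/

lemma isLink (d : Dart G) : G.IsLink d.edge d.vertex d.opp.vertex := d.inc.isLink_other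

@[simp] lemma edge_opp (d : Dart G) : d.opp.edge = d.edge := rfl

@[simp] lemma opp_opp (d : Dart G) : d.opp.opp = d := by
  ext
  · exact d.opp.isLink.right_unique d.isLink.symm
  · rfl

lemma vertex_opp_ne [G.Loopless] (d : Dart G) : d.opp.vertex ≠ d.vertex :=
  fun h => d.isLink.ne (congrArg Subtype.val h.symm)

lemma opp_ne [G.Loopless] (d : Dart G) : d.opp ≠ d :=
  fun h => d.vertex_opp_ne (congrArg Dart.vertex h)

lemma eq_or_eq_opp {a d : Dart G} (h : a.edge = d.edge) : a = d ∨ a = d.opp := by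
  have ha := a.inc
  rw [h] at ha
  rcases ha.eq_or_eq_of_isLink d.isLink with h' | h'
  · exact .inl (Dart.ext (Subtype.ext h') h)
  · exact .inr (Dart.ext (Subtype.ext h') h)

lemma exists_of_isLink {e : E(G)} {x y : V(G)} (h : G.IsLink e x y) :
    ∃ d : Dart G, d.edge = e ∧ d.vertex = x ∧ d.opp.vertex = y :=
  ⟨⟨x, e, h.inc_left⟩, rfl, rfl,
    Subtype.ext ((Dart.isLink ⟨x, e, h.inc_left⟩).right_unique h)⟩

lemma exists_of_inc {e : E(G)} {x : V(G)} (h : G.Inc e x) :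
    ∃ d : Dart G, d.edge = e ∧ d.vertex = x := ⟨⟨x, e, h⟩, rfl, rfl⟩

lemma exists_edge (e : E(G)) : ∃ d : Dart G, d.edge = e := by
  obtain ⟨x, y, h⟩ := G.exists_isLink_of_mem_edgeSet e.2
  exact ⟨⟨⟨x, h.left_mem⟩, e, h.inc_left⟩, rfl⟩

end Dart

instance [Finite V(G)] [Finite E(G)] : Finite (Dart G) :=
  Finite.of_injective (fun d : Dart G => (d.vertex, d.edge)) fun a b h => by
    simp only [Prod.mk.injEq] at h
    exact Dart.ext h.1 h.2

/-! ### Walks -/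

section Joined

variable {T T' : Set E(G)} {x y z : V(G)}

lemma Joined.refl (x : V(G)) : Joined G T x x := Relation.ReflTransGen.refl

lemma Joined.trans (h : Joined G T x y) (h' : Joined G T y z) : Joined G T x z :=
  Relation.ReflTransGen.trans h h'

lemma Joined.symm (h : Joined G T x y) : Joined G T y x := by
  refine Relation.ReflTransGen.head_induction_on h (.refl _) ?_
  rintro a b ⟨e, he, hl⟩ _ ih
  exact ih.tail ⟨e, he, hl.symm⟩

lemma Joined.mono (hT : T ⊆ T') (h : Joined G T x y) : Joined G T' x y :=
  Relation.ReflTransGen.mono (fun _ _ ⟨e, he, h⟩ => ⟨e, hT he, h⟩) _ _ h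

lemma Dart.joined (d : Dart G) (h : d.edge ∈ T) : Joined G T d.vertex d.opp.vertex :=
  Relation.ReflTransGen.single ⟨d.edge, h, d.isLink⟩

/-- A set of vertices that is closed under steps along `T` is closed under `Joined`. -/
lemma Joined.induction {P : V(G) → Prop} (h : Joined G T x y) (hx : P x)
    (hP : ∀ d : Dart G, d.edge ∈ T → Joined G T x d.vertex → P d.vertex → P d.opp.vertex) :
    P y := by
  have : Joined G T x y ∧ P y := by
    induction h with
    | refl => exact ⟨.refl _, hx⟩
    | tail _ h ih =>
      obtain ⟨e, he, hl⟩ := h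
      obtain ⟨d, rfl, rfl, rfl⟩ := Dart.exists_of_isLink hl
      exact ⟨ih.1.trans (d.joined he), hP d he ih.1 ih.2⟩
  exact this.2

/-- Crossing the new edge back undoes an earlier crossing, so at most one crossing, in one of the
two directions, is ever needed. -/
lemma Joined.of_insert (d : Dart G) (h : Joined G (insert d.edge T) x y) :
    Joined G T x y ∨ (Joined G T x d.vertex ∧ Joined G T d.opp.vertex y) ∨
      (Joined G T x d.opp.vertex ∧ Joined G T d.vertex y) := by
  refine Joined.induction (P := fun y => Joined G T x y ∨
    (Joined G T x d.vertex ∧ Joined G T d.opp.vertex y) ∨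
      (Joined G T x d.opp.vertex ∧ Joined G T d.vertex y)) h (.inl (.refl x)) ?_
  intro a ha _ ih
  by_cases haT : a.edge ∈ T
  · have := a.joined haT
    rcases ih with h | ⟨h, h'⟩ | ⟨h, h'⟩
    · exact .inl (h.trans this)
    · exact .inr (.inl ⟨h, h'.trans this⟩)
    · exact .inr (.inr ⟨h, h'.trans this⟩)
  · have had : a.edge = d.edge := (Set.mem_insert_iff.1 ha).resolve_right haT
    rcases Dart.eq_or_eq_opp had with rfl | rfl
    · rcases ih with h | ⟨h, h'⟩ | ⟨h, h'⟩
      · exact .inr (.inl ⟨h, .refl _⟩)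
      · exact .inr (.inl ⟨h, .refl _⟩)
      · exact .inl h
    · rw [Dart.opp_opp]
      rcases ih with h | ⟨h, h'⟩ | ⟨h, h'⟩
      · exact .inr (.inr ⟨h, .refl _⟩)
      · exact .inl h
      · exact .inr (.inr ⟨h, .refl _⟩)

/-- Stop the walk when it first arrives at `y`: the edges used before are not incident to `y`.
Without such an arrival the whole walk would avoid the edges at `y` and could not end there. -/
lemma Joined.exists_last (h : Joined G T x y) (hxy : x ≠ y) :
    ∃ d : Dart G, d.edge ∈ T ∧ d.vertex = y ∧ Joined G (T \ {d.edge}) x d.opp.vertex := by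
  by_contra! hc
  have key : Joined G {e ∈ T | ¬ G.Inc e y} x y := by
    refine h.induction (P := fun z => Joined G {e ∈ T | ¬ G.Inc e y} x z) (.refl x) ?_
    intro d hd _ ih
    by_cases hi : G.Inc d.edge y
    · rcases hi.eq_or_eq_of_isLink d.isLink with h1 | h1
      · exfalso
        have h1 := Subtype.ext h1
        subst h1
        have : Joined G {e ∈ T | ¬ G.Inc e d.vertex} x d.vertex → d.vertex ≠ d.vertex := by
          intro h
          refine h.induction (P := fun z => z ≠ d.vertex) hxy ?_
          rintro a ⟨_, ha⟩ _ _ h'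
          exact ha (h' ▸ a.isLink.inc_right)
        exact this ih rfl
      · exfalso
        have h1 := Subtype.ext h1
        refine hc d.opp hd h1.symm ?_
        rw [Dart.opp_opp]
        refine ih.mono ?_
        rintro e ⟨he, hne⟩
        refine ⟨he, ?_⟩
        rintro rfl
        exact hne hi
    · exact ih.trans (d.joined ⟨hd, hi⟩)
  have : y ≠ y := by
    refine key.induction (P := fun z => z ≠ y) hxy ?_
    rintro a ⟨_, ha⟩ _ _ h'
    exact ha (h' ▸ a.isLink.inc_right)
  exact this rfl

end Joined

/-! ### Spanning trees -/

/-- In a minimal connecting edge set no edge is redundant, so none has its ends joined by the rest.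
-/
lemma IsConnected.exists_isSpanningTree [Finite E(G)] (hG : IsConnected G) :
    ∃ T, IsSpanningTree G T := by
  obtain ⟨T, hT⟩ := (Set.toFinite {T : Set E(G) | ∀ x y : V(G), Joined G T x y}).exists_minimal
    ⟨Set.univ, hG.2⟩
  refine ⟨T, hT.prop, fun e he x y hl hj => ?_⟩
  have hsub : T ⊆ T \ {e} := by
    refine hT.le_of_le (y := T \ {e}) (fun a b => ?_) Set.sdiff_subset
    refine (hT.prop a b).induction (P := fun b => Joined G (T \ {e}) a b) (.refl a) ?_
    intro d hd _ ih
    by_cases hde : d.edge = e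
    · obtain ⟨d', rfl, rfl, rfl⟩ := Dart.exists_of_isLink hl
      rcases Dart.eq_or_eq_opp hde with rfl | rfl
      · exact ih.trans hj
      · rw [Dart.opp_opp]
        exact ih.trans hj.symm
    · exact ih.trans (d.joined ⟨hd, hde⟩)
  exact (hsub he).2 rfl

namespace IsSpanningTree

variable {T : Set E(G)} (hT : IsSpanningTree G T)
include hT

lemma not_joined_diff {d : Dart G} (hd : d.edge ∈ T) :
    ¬ Joined G (T \ {d.edge}) d.vertex d.opp.vertex :=
  hT.acyclic _ hd _ _ d.isLink

lemma joined_diff_or {d : Dart G} (hd : d.edge ∈ T) (u : V(G)) :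
    Joined G (T \ {d.edge}) d.vertex u ∨ Joined G (T \ {d.edge}) d.opp.vertex u := by
  have h := hT.joined d.vertex u
  rw [← Set.insert_sdiff_self_of_mem hd] at h
  rcases h.of_insert d with h | ⟨_, h⟩ | ⟨_, h⟩
  · exact .inl h
  · exact .inr h
  · exact .inl h

lemma joined_diff_opp_iff {d : Dart G} (hd : d.edge ∈ T) (u : V(G)) :
    Joined G (T \ {d.edge}) d.opp.vertex u ↔ ¬ Joined G (T \ {d.edge}) d.vertex u :=
  ⟨fun h h' => hT.not_joined_diff hd (h'.trans h.symm), (hT.joined_diff_or hd u).resolve_left⟩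

/-- Exchanging an edge `a` of a spanning tree for an edge `d` across the corresponding cut. -/
lemma exchange {a d : Dart G} (ha : a.edge ∈ T) (hd : d.edge ∉ T)
    (h₁ : Joined G (T \ {a.edge}) a.vertex d.vertex)
    (h₂ : Joined G (T \ {a.edge}) a.opp.vertex d.opp.vertex) :
    IsSpanningTree G (insert d.edge (T \ {a.edge})) where
  joined := by
    have hsub : T \ {a.edge} ⊆ insert d.edge (T \ {a.edge}) := Set.subset_insert _ _
    have key : ∀ u, Joined G (insert d.edge (T \ {a.edge})) a.vertex u := by
      intro u
      rcases hT.joined_diff_or ha u with h | h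
      · exact h.mono hsub
      · exact ((h₁.mono hsub).trans (d.joined (Set.mem_insert _ _))).trans
          ((h₂.symm.trans h).mono hsub)
    exact fun x y => (key x).symm.trans (key y)
  acyclic := by
    intro e he x y hl hj
    have hdT : d.edge ∉ T \ {a.edge} := fun h => hd h.1
    rcases Set.mem_insert_iff.1 he with rfl | he
    · rw [Set.insert_sdiff_self_of_notMem hdT] at hj
      have hnot : ¬ Joined G (T \ {a.edge}) d.vertex d.opp.vertex := fun h =>
        hT.not_joined_diff ha ((h₁.trans h).trans h₂.symm)
      obtain ⟨b, hb, rfl, rfl⟩ := Dart.exists_of_isLink hl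
      rcases Dart.eq_or_eq_opp hb with rfl | rfl
      · exact hnot hj
      · rw [Dart.opp_opp] at hj
        exact hnot hj.symm
    · have hed : e ≠ d.edge := fun h => hdT (h ▸ he)
      rw [Set.insert_sdiff_of_notMem _ (by simpa using hed.symm)] at hj
      obtain ⟨b, rfl, rfl, rfl⟩ := Dart.exists_of_isLink hl
      have hb := b.joined he
      have hsub : (T \ {a.edge}) \ {b.edge} ⊆ T \ {a.edge} := Set.sdiff_subset
      rcases hj.of_insert d with h | ⟨h, h'⟩ | ⟨h, h'⟩
      · exact hT.not_joined_diff he.1 (h.mono (Set.sdiff_subset_sdiff_left Set.sdiff_subset))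
      · refine hT.not_joined_diff ha ?_
        exact h₁.trans ((h.symm.mono hsub).trans (hb.trans ((h'.symm.mono hsub).trans h₂.symm)))
      · refine hT.not_joined_diff ha ?_
        exact h₁.trans ((h'.mono hsub).trans (hb.symm.trans ((h.mono hsub).trans h₂.symm)))

/-- Each vertex other than the root `q` has a parent edge, the last edge of the path from `q`. -/
lemma exists_parent {q u : V(G)} (h : q ≠ u) :
    ∃ d : Dart G, d.edge ∈ T ∧ d.vertex = u ∧ Joined G (T \ {d.edge}) q d.opp.vertex :=
  (hT.joined q u).exists_last h

lemma parent_injective {q : V(G)} {a b : Dart G} (ha : a.edge ∈ T)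
    (hqa : Joined G (T \ {a.edge}) q a.opp.vertex)
    (hqb : Joined G (T \ {b.edge}) q b.opp.vertex) (hab : a.edge = b.edge) :
    a.vertex = b.vertex := by
  rcases Dart.eq_or_eq_opp hab with rfl | rfl
  · rfl
  · exfalso
    rw [Dart.opp_opp, Dart.edge_opp] at hqa
    exact hT.not_joined_diff (d := b) ha (hqa.symm.trans hqb)

lemma parent_unique {q : V(G)} {a b : Dart G} (ha : a.edge ∈ T) (hb : b.edge ∈ T)
    (hqa : Joined G (T \ {a.edge}) q a.opp.vertex)
    (hqb : Joined G (T \ {b.edge}) q b.opp.vertex) (hab : a.vertex = b.vertex) :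
    a.edge = b.edge := by
  by_contra hne
  have ha' := hT.not_joined_diff ha
  have hb' := hT.not_joined_diff hb
  have hqa' := hqa
  rw [← Set.insert_sdiff_self_of_mem (a := b.edge) (s := T \ {a.edge}) ⟨hb, Ne.symm hne⟩] at hqa
  have s₁ : (T \ {a.edge}) \ {b.edge} ⊆ T \ {a.edge} := Set.sdiff_subset
  have s₂ : (T \ {a.edge}) \ {b.edge} ⊆ T \ {b.edge} := Set.sdiff_subset_sdiff_left Set.sdiff_subset
  rcases hqa.of_insert b with h | ⟨h, h'⟩ | ⟨h, h'⟩
  · refine hb' ?_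
    have := (a.joined (T := T \ {b.edge}) ⟨ha, hne⟩).trans ((h.symm.mono s₂).trans hqb)
    rwa [hab] at this
  · exact ha' ((hab ▸ h.symm.mono s₁).trans hqa')
  · exact ha' (hab ▸ h'.mono s₁)

open Classical in
-- Root the tree outside `S`: the parent edges of the vertices of `S` are distinct.
lemma card_le_card_inc [Fintype E(G)] (S : Finset V(G)) (hS : ∃ q, q ∉ S) :
    S.card ≤ (Finset.univ.filter fun e : E(G) => e ∈ T ∧ ∃ u ∈ S, G.Inc e u).card := by
  obtain ⟨q, hq⟩ := hS
  have : ∀ u : S, ∃ d : Dart G, d.edge ∈ T ∧ d.vertex = u ∧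
      Joined G (T \ {d.edge}) q d.opp.vertex := fun u =>
    hT.exists_parent fun h => hq (h ▸ u.2)
  choose p hp hpu hpq using this
  rw [← Fintype.card_coe S]
  refine Finset.card_le_card_of_injOn (fun u => (p u).edge) ?_ ?_
  · intro u _
    simp only [Finset.coe_filter, Finset.mem_univ, true_and, Set.mem_ofPred_eq]
    exact ⟨hp u, u, u.2, hpu u ▸ (p u).inc⟩
  · intro u _ u' _ h
    have := hT.parent_injective (hp u) (hpq u) (hpq u') h
    rw [hpu, hpu] at this
    exact Subtype.ext this

open Classical in
-- Rooting at `q` matches every other vertex with its parent edge, and every tree edge arises in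
-- this way.
lemma card_add_one [Fintype V(G)] [Fintype E(G)] (q : V(G)) :
    (Finset.univ.filter fun e : E(G) => e ∈ T).card + 1 = Fintype.card V(G) := by
  have hcard : (Finset.univ.erase q).card + 1 = Fintype.card V(G) :=
    Finset.card_erase_add_one (Finset.mem_univ q)
  rw [← hcard, add_left_inj]
  refine le_antisymm ?_ ?_
  · have : ∀ e : {e // e ∈ T}, ∃ d : Dart G, d.edge = e ∧
        Joined G (T \ {d.edge}) q d.opp.vertex := by
      rintro ⟨e, he⟩
      obtain ⟨d, rfl⟩ := Dart.exists_edge e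
      rcases hT.joined_diff_or he q with h | h
      · exact ⟨d.opp, rfl, by simpa using h.symm⟩
      · exact ⟨d, rfl, h.symm⟩
    choose p hp hpq using this
    have hmem : ∀ e, (p e).edge ∈ T := fun e => by rw [hp]; exact e.2
    rw [← Fintype.card_subtype]
    refine Finset.card_le_card_of_injOn (fun e => (p e).vertex) ?_ ?_
    · intro e _
      simp only [Finset.coe_erase, Finset.coe_univ, Set.mem_sdiff, Set.mem_univ, true_and,
        Set.mem_singleton_iff]
      intro h
      exact hT.not_joined_diff (hmem e) (h ▸ hpq e)
    · intro e _ e' _ h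
      have := hT.parent_unique (hmem e) (hmem e') (hpq e) (hpq e') h
      rw [hp, hp] at this
      exact Subtype.ext this
  · refine (hT.card_le_card_inc _ ⟨q, Finset.notMem_erase q _⟩).trans (Finset.card_le_card ?_)
    intro e
    simp +contextual

open Classical in
/-- The edges of the tree that are incident to the far side of one of its edges. -/
lemma card_inc_side_le [Fintype V(G)] [Fintype E(G)] {d : Dart G} (hd : d.edge ∈ T) :
    (Finset.univ.filter fun e : E(G) => e ∈ T ∧
      ∃ u, Joined G (T \ {d.edge}) d.opp.vertex u ∧ G.Inc e u).card ≤
    (Finset.univ.filter fun u : V(G) => Joined G (T \ {d.edge}) d.opp.vertex u).card := by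
  set q := d.vertex with hq
  set S := Finset.univ.filter fun u : V(G) => Joined G (T \ {d.edge}) d.opp.vertex u with hS
  set A := Finset.univ.filter fun e : E(G) => e ∈ T ∧
      ∃ u, Joined G (T \ {d.edge}) d.opp.vertex u ∧ G.Inc e u with hA
  set B := Finset.univ.filter fun e : E(G) => e ∈ T ∧
      ¬ ∃ u, Joined G (T \ {d.edge}) d.opp.vertex u ∧ G.Inc e u with hB
  have hAB : A.card + B.card = (Finset.univ.filter fun e : E(G) => e ∈ T).card := by
    rw [hA, hB, ← Finset.filter_filter, ← Finset.filter_filter]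
    exact Finset.card_filter_add_card_filter_not _
  have hSc : S.card + Sᶜ.card = Fintype.card V(G) := Finset.card_add_card_compl S
  have hqS : q ∈ Sᶜ := by
    simp only [hS, Finset.mem_compl, Finset.mem_filter, Finset.mem_univ, true_and]
    exact fun h => hT.not_joined_diff hd h.symm
  have herase := Finset.card_erase_add_one hqS
  -- The root is the near end of `d`. The parent edges of the other near vertices stay on the near
  -- side, so they miss `S`; subtracting them from the #V - 1 tree edges leaves at most #S.
  have hle : (Sᶜ.erase q).card ≤ B.card := by
    have : ∀ u : {u // u ∈ Sᶜ.erase q}, ∃ d : Dart G, d.edge ∈ T ∧ d.vertex = u ∧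
        Joined G (T \ {d.edge}) q d.opp.vertex := fun u =>
      hT.exists_parent (Finset.ne_of_mem_erase u.2).symm
    choose p hp hpu hpq using this
    rw [← Fintype.card_coe (Sᶜ.erase q)]
    refine Finset.card_le_card_of_injOn (fun u => (p u).edge) ?_ ?_
    · intro u _
      simp only [hB, Finset.coe_filter, Finset.mem_univ, true_and, Set.mem_ofPred_eq]
      refine ⟨hp u, ?_⟩
      rintro ⟨w, hw, hinc⟩
      have huS : ¬ Joined G (T \ {d.edge}) d.opp.vertex (p u).vertex := by
        have := Finset.mem_of_mem_erase u.2
        simpa [hS, hpu] using this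
      have hne : (p u).edge ≠ d.edge := by
        intro h
        rcases Dart.eq_or_eq_opp h with h | h
        · exact Finset.ne_of_mem_erase u.2 (by rw [← hpu, h])
        · exact huS (h ▸ .refl _)
      have hstep := (p u).joined (T := T \ {d.edge}) ⟨hp u, hne⟩
      rcases hinc.eq_or_eq_of_isLink (p u).isLink with h | h
      · exact huS (Subtype.ext h ▸ hw)
      · exact huS ((Subtype.ext h ▸ hw : Joined G _ _ (p u).opp.vertex).trans hstep.symm)
    · intro u _ u' _ h
      have := hT.parent_injective (hp u) (hpq u) (hpq u') h
      rw [hpu, hpu] at this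
      exact Subtype.ext this
  have := hT.card_add_one q
  omega

end IsSpanningTree

end Bernardi

namespace Bernardi

/-! ### Merging two cycles of a permutation -/

section Perm

open Equiv

variable {D : Type*} [Finite D] [DecidableEq D] {σ : Perm D} {a b x y z : D}

/-- The product sends `b` to `σ a` and then follows `σ` until it is back at `a`. So from `b` it runs
through the whole cycle of `a` before anything else. -/
lemma iterate_mul_swap (h : ¬ σ.SameCycle a b) (hz : σ.SameCycle a z) :
    ∃ k, 0 < k ∧ (σ * swap a b)^[k] b = z ∧
      ∀ j, 0 < j → j ≤ k → σ.SameCycle a ((σ * swap a b)^[j] b) := by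
  classical
  obtain ⟨i, hi, -, hiz⟩ := hz.exists_pow_eq''
  have hex : ∃ k, 0 < k ∧ (σ ^ k) a = z := ⟨i, hi, hiz⟩
  obtain ⟨k, ⟨hk0, hkz⟩, hmin⟩ : ∃ k, (0 < k ∧ (σ ^ k) a = z) ∧
      ∀ m < k, ¬ (0 < m ∧ (σ ^ m) a = z) := ⟨_, Nat.find_spec hex, fun m hm => Nat.find_min hex hm⟩
  have key : ∀ j, j + 1 ≤ k → (σ * swap a b)^[j + 1] b = (σ ^ (j + 1)) a := by
    intro j
    induction j with
    | zero => intro _; simp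
    | succ j ih =>
      intro hj
      rw [Function.iterate_succ_apply', ih (by omega), Perm.mul_apply, swap_apply_of_ne_of_ne,
        ← Perm.mul_apply, ← pow_succ']
      · intro ha
        -- A return to `a` after `j + 1` steps would make `z` reachable in only `k - (j + 1)` steps.
        refine hmin (k - (j + 1)) (by omega) ⟨by omega, ?_⟩
        rw [← hkz]
        nth_rw 1 [← ha]
        rw [← Perm.mul_apply, ← pow_add, Nat.sub_add_cancel (by omega)]
      · intro hb
        exact h ⟨(j + 1 : ℕ), by rw [zpow_natCast, hb]⟩
  refine ⟨k, hk0, ?_, ?_⟩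
  · obtain ⟨m, rfl⟩ := Nat.exists_eq_add_of_le' hk0
    rw [key _ le_rfl, hkz]
  · intro j hj hjk
    obtain ⟨m, rfl⟩ := Nat.exists_eq_add_of_le' hj
    rw [key _ hjk]
    exact ⟨((m + 1 : ℕ) : ℤ), by rw [zpow_natCast]⟩

omit [Finite D] [DecidableEq D] in
lemma sameCycle_of_iterate {τ : Perm D} {k : ℕ} (h : τ^[k] x = y) : τ.SameCycle x y :=
  ⟨k, by rw [zpow_natCast, ← Perm.iterate_eq_pow, h]⟩

lemma sameCycle_mul_swap (h : ¬ σ.SameCycle a b) : (σ * swap a b).SameCycle a b := by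
  obtain ⟨k, -, hk, -⟩ := iterate_mul_swap h (.refl _ a)
  exact (sameCycle_of_iterate hk).symm

lemma SameCycle.mul_swap (h : ¬ σ.SameCycle a b) (hxy : σ.SameCycle x y) :
    (σ * swap a b).SameCycle x y := by
  have hab := sameCycle_mul_swap h
  have step : ∀ x, (σ * swap a b).SameCycle x (σ x) := by
    intro x
    by_cases hxa : x = a
    · subst hxa
      refine hab.trans (sameCycle_of_iterate (k := 1) ?_)
      simp
    by_cases hxb : x = b
    · subst hxb
      refine hab.symm.trans (sameCycle_of_iterate (k := 1) ?_)
      simp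
    · refine sameCycle_of_iterate (k := 1) ?_
      simp [swap_apply_of_ne_of_ne hxa hxb]
  obtain ⟨n, rfl⟩ := hxy.exists_nat_pow_eq
  clear hxy
  induction n with
  | zero => exact .refl _ _
  | succ n ih =>
    rw [pow_succ', Perm.mul_apply]
    exact ih.trans (step _)

end Perm

variable {α β : Type*} {G : Graph α β}

/-! ### The tour as a permutation of the half-edges -/

section TourPerm

variable (R : RibbonStructure G) (T : Set E(G))

open Classical in
/-- The involution that reverses the half-edges belonging to `T`. -/
noncomputable def flip : Equiv.Perm (Dart G) :=
  Function.Involutive.toPerm (fun d => if d.edge ∈ T then d.opp else d) fun d => by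
    by_cases h : d.edge ∈ T <;> simp [h]

/-- The steps of the tour of `T`, as a permutation of the half-edges. -/
noncomputable def tourPerm : Equiv.Perm (Dart G) := R.next * flip T

variable {R T}

@[simp] lemma coe_tourPerm : ⇑(tourPerm R T) = tourStep R T := by
  funext d
  by_cases h : d.edge ∈ T <;> simp [tourPerm, flip, tourStep, h, Function.Involutive.toPerm]

lemma tourStep_of_mem {d : Dart G} (h : d.edge ∈ T) : tourStep R T d = R.next d.opp := by
  simp [tourStep, h]

lemma tourStep_of_notMem {d : Dart G} (h : d.edge ∉ T) : tourStep R T d = R.next d := by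
  simp [tourStep, h]

open Classical in
lemma tourPerm_insert {d : Dart G} (h : d.edge ∉ T) :
    tourPerm R (insert d.edge T) = tourPerm R T * Equiv.swap d d.opp := by
  ext1 a
  rw [Equiv.Perm.mul_apply, coe_tourPerm, coe_tourPerm]
  by_cases had : a.edge = d.edge
  · rw [tourStep_of_mem (by simp [had])]
    rcases Dart.eq_or_eq_opp had with rfl | rfl
    · rw [Equiv.swap_apply_left, tourStep_of_notMem (by simpa)]
    · rw [Equiv.swap_apply_right, tourStep_of_notMem (by simpa), Dart.opp_opp]
  · have h₁ : a ≠ d := fun h => had (congrArg Dart.edge h)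
    have h₂ : a ≠ d.opp := by
      rintro rfl
      exact had rfl
    rw [Equiv.swap_apply_of_ne_of_ne h₁ h₂]
    simp [tourStep, had]

lemma joined_tourStep (d : Dart G) (T' : Set E(G)) (h : d.edge ∈ T → d.edge ∈ T') :
    Joined G T' d.vertex (tourStep R T d).vertex := by
  by_cases hd : d.edge ∈ T
  · rw [tourStep_of_mem hd, R.vertex_next]
    exact d.joined (h hd)
  · rw [tourStep_of_notMem hd, R.vertex_next]
    exact .refl _

lemma joined_of_sameCycle [Finite (Dart G)] {a b : Dart G} (h : (tourPerm R T).SameCycle a b) :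
    Joined G T a.vertex b.vertex := by
  obtain ⟨n, rfl⟩ := h.exists_nat_pow_eq
  clear h
  induction n with
  | zero => exact .refl _
  | succ n ih =>
    rw [pow_succ', Equiv.Perm.mul_apply]
    refine ih.trans ?_
    rw [coe_tourPerm]
    exact joined_tourStep _ _ id

/-- Build the forest edge by edge. With no edges the cycles are the vertices, by the ribbon
structure; each new edge joins two components and merges the two corresponding cycles. -/
lemma sameCycle_of_joined [Finite (Dart G)] (hfin : T.Finite)
    (hT : ∀ d : Dart G, d.edge ∈ T → ¬ Joined G (T \ {d.edge}) d.vertex d.opp.vertex)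
    {a b : Dart G} (h : Joined G T a.vertex b.vertex) : (tourPerm R T).SameCycle a b := by
  classical
  induction T, hfin using Set.Finite.induction_on generalizing a b with
  | empty =>
    have hv : a.vertex = b.vertex :=
      h.induction (P := fun z => a.vertex = z) rfl (by simp)
    have : tourPerm R ∅ = R.next := by
      ext1 d
      rw [coe_tourPerm, tourStep_of_notMem (by simp)]
    rw [this]
    exact R.sameCycle _ _ hv
  | @insert e T he _ ih =>
    obtain ⟨d, rfl⟩ := Dart.exists_edge e
    have ih' : ∀ {a b : Dart G}, Joined G T a.vertex b.vertex → (tourPerm R T).SameCycle a b := by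
      intro a b h
      refine ih (fun c hc hj => hT c (Set.mem_insert_of_mem _ hc) (hj.mono ?_)) h
      exact Set.sdiff_subset_sdiff_left (Set.subset_insert _ _)
    have hd : ¬ (tourPerm R T).SameCycle d d.opp := by
      intro h
      refine hT d (Set.mem_insert _ _) ?_
      rw [Set.insert_sdiff_self_of_notMem he]
      exact joined_of_sameCycle h
    rw [tourPerm_insert he]
    have hd' := sameCycle_mul_swap hd
    rcases h.of_insert d with h | ⟨h, h'⟩ | ⟨h, h'⟩
    · exact SameCycle.mul_swap hd (ih' h)
    · exact ((SameCycle.mul_swap hd (ih' h)).trans hd').trans (SameCycle.mul_swap hd (ih' h'))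
    · exact ((SameCycle.mul_swap hd (ih' h)).trans hd'.symm).trans (SameCycle.mul_swap hd (ih' h'))

namespace IsSpanningTree

variable [Finite V(G)] [Finite E(G)] (hT : IsSpanningTree G T)
include hT

lemma exists_iterate (a b : Dart G) : ∃ k, (tourStep R T)^[k] a = b := by
  have h : (tourPerm R T).SameCycle a b :=
    sameCycle_of_joined (Set.toFinite T) (fun d hd => hT.not_joined_diff hd) (hT.joined _ _)
  obtain ⟨k, hk⟩ := h.exists_nat_pow_eq
  exact ⟨k, by rw [← hk, ← Equiv.Perm.iterate_eq_pow, coe_tourPerm]⟩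

/-- After walking along the edge of `d.opp` to the side of `d.vertex`, the tour meets every
half-edge of that side before it leaves that side. -/
lemma exists_iterate_side {d z : Dart G} (hd : d.edge ∈ T)
    (hz : Joined G (T \ {d.edge}) d.vertex z.vertex) :
    ∃ k, 0 < k ∧ (tourStep R T)^[k] d.opp = z ∧ ∀ j, 0 < j → j ≤ k →
      Joined G (T \ {d.edge}) d.vertex ((tourStep R T)^[j] d.opp).vertex := by
  classical
  have hacyc : ∀ c : Dart G, c.edge ∈ T \ {d.edge} →
      ¬ Joined G ((T \ {d.edge}) \ {c.edge}) c.vertex c.opp.vertex := fun c hc hj =>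
    hT.not_joined_diff hc.1 (hj.mono (Set.sdiff_subset_sdiff_left Set.sdiff_subset))
  -- Without the edge of `d` the half-edges form one cycle per side. Restoring it merges them, and
  -- from `d.opp` the merged tour runs through the cycle of `d` first.
  have hne : ¬ (tourPerm R (T \ {d.edge})).SameCycle d d.opp := fun h =>
    hT.not_joined_diff hd (joined_of_sameCycle h)
  obtain ⟨k, hk, hkz, hkj⟩ := iterate_mul_swap hne
    (sameCycle_of_joined (Set.toFinite _) hacyc hz)
  rw [← tourPerm_insert (by simp), Set.insert_sdiff_self_of_mem hd, coe_tourPerm] at hkz hkj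
  exact ⟨k, hk, hkz, fun j hj hjk => joined_of_sameCycle (hkj j hj hjk)⟩

end IsSpanningTree

end TourPerm

/-! ### The first meeting with an edge -/

section Meet

variable (R : RibbonStructure G) (T : Set E(G))

/-- The time at which the tour of `T` starting at `d` first meets the edge `f`. -/
noncomputable def meetTime (d : Dart G) (f : E(G)) : ℕ :=
  sInf {i | ((tourStep R T)^[i] d).edge = f}

/-- The half-edge at which the tour of `T` starting at `d` first meets the edge `f`. -/
noncomputable def meetDart (d : Dart G) (f : E(G)) : Dart G :=
  (tourStep R T)^[meetTime R T d f] d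

variable {R T}

lemma edge_ne_of_lt_meetTime {d : Dart G} {f : E(G)} {j : ℕ} (h : j < meetTime R T d f) :
    ((tourStep R T)^[j] d).edge ≠ f := fun h' => Nat.notMem_of_lt_sInf h h'

lemma meetTime_eq {d : Dart G} {f : E(G)} {k : ℕ} (hk : ((tourStep R T)^[k] d).edge = f)
    (h : ∀ j < k, ((tourStep R T)^[j] d).edge ≠ f) : meetTime R T d f = k := by
  refine le_antisymm (Nat.sInf_le hk) ?_
  by_contra! hlt
  exact h _ hlt (Nat.sInf_mem (s := {i | ((tourStep R T)^[i] d).edge = f}) ⟨k, hk⟩)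

lemma meetTime_le {d : Dart G} {f : E(G)} {k : ℕ} (hk : ((tourStep R T)^[k] d).edge = f) :
    meetTime R T d f ≤ k := Nat.sInf_le hk

lemma meetDart_eq {d z : Dart G} {f : E(G)} {k : ℕ} (hk : (tourStep R T)^[k] d = z)
    (hz : z.edge = f) (h : ∀ j < k, ((tourStep R T)^[j] d).edge ≠ f) :
    meetDart R T d f = z := by
  rw [meetDart, meetTime_eq (by rw [hk, hz]) h, hk]

lemma joined_iterate_of_edge_ne {d : Dart G} {e : E(G)} {n : ℕ}
    (h : ∀ j < n, ((tourStep R T)^[j] d).edge ≠ e) {j : ℕ} (hj : j ≤ n) :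
    Joined G (T \ {e}) d.vertex ((tourStep R T)^[j] d).vertex := by
  induction j with
  | zero => exact .refl _
  | succ j ih =>
    rw [Function.iterate_succ_apply']
    exact (ih (by omega)).trans (joined_tourStep _ _ fun h' => ⟨h', h j (by omega)⟩)

lemma iterate_congr {T' : Set E(G)} {d : Dart G} {n : ℕ}
    (h : ∀ j < n, ((tourStep R T)^[j] d).edge ∈ T ↔ ((tourStep R T)^[j] d).edge ∈ T') {j : ℕ}
    (hj : j ≤ n) : (tourStep R T')^[j] d = (tourStep R T)^[j] d := by
  induction j with
  | zero => rfl
  | succ j ih =>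
    rw [Function.iterate_succ_apply', Function.iterate_succ_apply', ih (by omega)]
    have := h j (by omega)
    by_cases hT : ((tourStep R T)^[j] d).edge ∈ T
    · rw [tourStep_of_mem hT, tourStep_of_mem (this.1 hT)]
    · rw [tourStep_of_notMem hT, tourStep_of_notMem (mt this.2 hT)]

/-- Before the tour meets the edge `e` it stays on the near side of `e`. -/
lemma joined_meetDart_of_le {d : Dart G} {e : E(G)} {j : ℕ} (h : j ≤ meetTime R T d e) :
    Joined G (T \ {e}) (meetDart R T d e).vertex ((tourStep R T)^[j] d).vertex :=
  (joined_iterate_of_edge_ne (fun _ h => edge_ne_of_lt_meetTime h) le_rfl).symm.trans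
    (joined_iterate_of_edge_ne (fun _ h => edge_ne_of_lt_meetTime h) h)

namespace IsSpanningTree

variable [Finite V(G)] [Finite E(G)] (hT : IsSpanningTree G T)
include hT

@[simp] lemma edge_meetDart (d : Dart G) (f : E(G)) : (meetDart R T d f).edge = f := by
  obtain ⟨z, rfl⟩ := Dart.exists_edge f
  obtain ⟨k, rfl⟩ := hT.exists_iterate (R := R) d z
  exact Nat.sInf_mem (s := {i | ((tourStep R T)^[i] d).edge = _}) ⟨k, rfl⟩

lemma meetDart_iterate {d : Dart G} {f : E(G)} {n : ℕ}
    (h : ∀ j < n, ((tourStep R T)^[j] d).edge ≠ f) :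
    meetDart R T ((tourStep R T)^[n] d) f = meetDart R T d f := by
  symm
  set d' := (tourStep R T)^[n] d with hd'
  refine meetDart_eq (k := meetTime R T d' f + n) ?_ (hT.edge_meetDart _ _) ?_
  · rw [Function.iterate_add_apply]
    rfl
  · intro j hj
    by_cases hjn : j < n
    · exact h j hjn
    · obtain ⟨i, rfl⟩ := Nat.exists_eq_add_of_le' (not_lt.1 hjn)
      rw [Function.iterate_add_apply]
      exact edge_ne_of_lt_meetTime (lt_of_add_lt_add_right hj)

/-- After the tour has met the edge `e` of the tree, it visits the whole far side of `e` before
it returns. -/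
lemma joined_meetDart_of_ge {d z : Dart G} {e : E(G)} (he : e ∈ T)
    (hz : Joined G (T \ {e}) (meetDart R T d e).opp.vertex z.vertex)
    (hne : z.edge ≠ e) (h : meetTime R T d e ≤ meetTime R T d z.edge) :
    Joined G (T \ {e}) (meetDart R T d e).opp.vertex (meetDart R T d z.edge).vertex := by
  set a := meetDart R T d e with ha
  have hae : a.edge = e := hT.edge_meetDart _ _
  have hz' : Joined G (T \ {a.opp.edge}) a.opp.vertex z.vertex := by simpa [hae] using hz
  obtain ⟨k, hk, hkz, hkj⟩ := hT.exists_iterate_side (R := R) (d := a.opp) (by simpa [hae]) hz'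
  rw [Dart.opp_opp] at hkz hkj
  -- The excursion to the far side contains `z`, so the first meeting with its edge happens no later
  -- and falls within the excursion.
  have hz_time : meetTime R T d z.edge ≤ k + meetTime R T d e :=
    meetTime_le (by rw [Function.iterate_add_apply]; exact congrArg Dart.edge hkz)
  have hpos : meetTime R T d e ≠ meetTime R T d z.edge := by
    intro h'
    refine hne ?_
    rw [← hT.edge_meetDart (R := R) d z.edge, ← hT.edge_meetDart (R := R) d e, meetDart, meetDart,
      h']
  obtain ⟨i, hi⟩ := Nat.exists_eq_add_of_le' h
  have := hkj i (by omega) (by omega)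
  rw [Dart.edge_opp, hae] at this
  rw [meetDart, hi, Function.iterate_add_apply]
  exact this

end IsSpanningTree

end Meet

/-! ### Sums of chips -/

section ChipSum

variable [Fintype E(G)]

open Classical in
/-- The divisor in which each edge `f` outside `T` contributes a chip at `c f`. -/
noncomputable def chipSum (T : Set E(G)) (c : E(G) → V(G)) : V(G) → ℤ :=
  ∑ f with f ∉ T, pointDiv (c f)

lemma chipSum_eq_sum_subtype (T : Set E(G)) (c : E(G) → V(G)) [Fintype {f : E(G) // f ∉ T}] :
    chipSum T c = ∑ f : {f : E(G) // f ∉ T}, pointDiv (c f) := by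
  classical
  exact Finset.sum_subtype _ (by simp) _

open Classical in
lemma sum_chipSum (T : Set E(G)) (c : E(G) → V(G)) (S : Finset V(G)) :
    ∑ u ∈ S, chipSum T c u = (Finset.univ.filter fun f => f ∉ T ∧ c f ∈ S).card := by
  simp only [chipSum, Finset.sum_apply, pointDiv]
  rw [Finset.sum_comm, ← Finset.filter_filter, Finset.card_filter]
  push_cast
  refine Finset.sum_congr rfl fun f _ => ?_
  simp [Pi.single_apply]

/-- The divisor `β_(v,e)(T)`, where the half-edge `d` stands for `(v, e)`. -/
noncomputable def tourDivisor (R : RibbonStructure G) (d : Dart G) (T : Set E(G)) : V(G) → ℤ :=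
  chipSum T fun f => (meetDart R T d f).vertex

lemma bernardiDivisor_eq (R : RibbonStructure G) (v : V(G)) (e : EdgeAt G v) (T : Set E(G)) :
    bernardiDivisor R v e T = tourDivisor R ⟨v, e.1, e.2⟩ T := by
  classical
  rw [tourDivisor, chipSum_eq_sum_subtype]
  rfl

end ChipSum

/-! ### Injectivity of the Bernardi map -/

section Injective

variable [Fintype V(G)] [Fintype E(G)] {R : RibbonStructure G} {T T' : Set E(G)}

/-- Let `S` be the far side of the edge `a` at which the tours diverge, and `A` the set of edges at
`S` not faced up to then. On `S`, the tour of `T` leaves at least #(A \ T) chips and that of `T'` at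
most #(A \ T'). But `A` contains fewer edges of `T` than of `T'`, because `T` spends `a` on reaching
`S`. -/
lemma IsSpanningTree.tourDivisor_ne (hT : IsSpanningTree G T) (hT' : IsSpanningTree G T')
    {d : Dart G} {n : ℕ}
    (hn : ∀ j < n, ((tourStep R T)^[j] d).edge ∈ T ↔ ((tourStep R T)^[j] d).edge ∈ T')
    (h : ((tourStep R T)^[n] d).edge ∈ T) (h' : ((tourStep R T)^[n] d).edge ∉ T') :
    tourDivisor R d T ≠ tourDivisor R d T' := by
  classical
  intro heq
  set a := (tourStep R T)^[n] d with ha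
  have hbefore : ∀ j < n, ((tourStep R T)^[j] d).edge ≠ a.edge := by
    intro j hj he
    have := hn j hj
    rw [he] at this
    exact h' (this.1 h)
  have htime : meetTime R T d a.edge = n := meetTime_eq rfl hbefore
  have hmeet : meetDart R T d a.edge = a := meetDart_eq rfl rfl hbefore
  set S := Finset.univ.filter fun u : V(G) => Joined G (T \ {a.edge}) a.opp.vertex u with hS
  have memS : ∀ u, u ∈ S ↔ Joined G (T \ {a.edge}) a.opp.vertex u := by simp [hS]
  have near : ∀ j ≤ n, ((tourStep R T)^[j] d).vertex ∉ S := by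
    intro j hj hjS
    rw [memS, hT.joined_diff_opp_iff h] at hjS
    refine hjS ?_
    have := joined_meetDart_of_le (R := R) (T := T) (d := d) (e := a.edge) (htime.symm ▸ hj)
    rwa [hmeet] at this
  set A := Finset.univ.filter fun e : E(G) => (∃ u ∈ S, G.Inc e u) ∧
    ∀ j ≤ n, ((tourStep R T)^[j] d).edge ≠ e with hA
  have h₁ : (A.filter fun e => e ∉ T).card ≤
      (Finset.univ.filter fun f => f ∉ T ∧ (meetDart R T d f).vertex ∈ S).card := by
    refine Finset.card_le_card fun e he => ?_
    simp only [hA, Finset.mem_filter, Finset.mem_univ, true_and] at he ⊢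
    obtain ⟨⟨⟨u, hu, hinc⟩, hmet⟩, heT⟩ := he
    refine ⟨heT, ?_⟩
    obtain ⟨z, rfl, rfl⟩ := Dart.exists_of_inc hinc
    rw [memS] at hu ⊢
    have := hT.joined_meetDart_of_ge (R := R) (d := d) (z := z) (e := a.edge) h
      (by rwa [hmeet]) (fun hz => heT (hz ▸ h)) ?_
    · rwa [hmeet] at this
    · by_contra! hlt
      rw [htime] at hlt
      exact hmet _ hlt.le (hT.edge_meetDart d z.edge)
  have h₂ : (Finset.univ.filter fun f => f ∉ T' ∧ (meetDart R T' d f).vertex ∈ S).card ≤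
      (A.filter fun e => e ∉ T').card := by
    refine Finset.card_le_card fun e he => ?_
    simp only [hA, Finset.mem_filter, Finset.mem_univ, true_and] at he ⊢
    obtain ⟨heT, heS⟩ := he
    refine ⟨⟨⟨_, heS, ?_⟩, fun j hj hje => ?_⟩, heT⟩
    · have := (meetDart R T' d e).inc
      rwa [hT'.edge_meetDart] at this
    · rw [← iterate_congr hn hj] at hje
      have hle := (meetTime_le hje).trans hj
      rw [meetDart, iterate_congr hn hle] at heS
      exact near _ hle heS
  have h₃ : (A.filter fun e => e ∈ T).card + 1 ≤ S.card := by
    have haA : a.edge ∉ A.filter fun e => e ∈ T := by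
      simp only [hA, Finset.mem_filter]
      exact fun hh => hh.1.2.2 n le_rfl rfl
    rw [← Finset.card_insert_of_notMem haA]
    refine (Finset.card_le_card fun e he => ?_).trans (hT.card_inc_side_le h)
    rcases Finset.mem_insert.1 he with rfl | he
    · simp only [Finset.mem_filter, Finset.mem_univ, true_and]
      exact ⟨h, _, .refl _, a.opp.inc⟩
    · simp only [hA, Finset.mem_filter, Finset.mem_univ, true_and, memS] at he ⊢
      exact ⟨he.2, he.1.1⟩
  -- An edge of `T'` faced before the divergence also lies in `T` and differs from `a`; it was faced
  -- from the near side, so it has no end in `S`.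
  have h₄ : S.card ≤ (A.filter fun e => e ∈ T').card := by
    refine (hT'.card_le_card_inc S ⟨_, near n le_rfl⟩).trans (Finset.card_le_card fun e he => ?_)
    simp only [hA, Finset.mem_filter, Finset.mem_univ, true_and] at he ⊢
    obtain ⟨heT, u, hu, hinc⟩ := he
    refine ⟨⟨⟨u, hu, hinc⟩, fun j hj hje => ?_⟩, heT⟩
    rcases hj.lt_or_eq with hlt | rfl
    · set b := (tourStep R T)^[j] d with hb
      have hbT : b.edge ∈ T \ {a.edge} := ⟨(hn j hlt).2 (hje ▸ heT), hbefore j hlt⟩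
      have hbS := near j hj
      rw [← hje] at hinc
      rcases hinc.eq_or_eq_of_isLink b.isLink with hu' | hu'
      · exact hbS (Subtype.ext hu' ▸ hu)
      · have hu' := Subtype.ext hu'
        subst hu'
        rw [memS] at hu hbS
        exact hbS (hu.trans (b.joined hbT).symm)
    · exact h' (hje ▸ heT)
  have e₁ := sum_chipSum T (fun f => (meetDart R T d f).vertex) S
  have e₂ := sum_chipSum T' (fun f => (meetDart R T' d f).vertex) S
  change ∑ u ∈ S, tourDivisor R d T u = _ at e₁
  change ∑ u ∈ S, tourDivisor R d T' u = _ at e₂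
  rw [heq, e₂, Nat.cast_inj] at e₁
  have c₁ := Finset.card_filter_add_card_filter_not (s := A) (fun e => e ∈ T)
  have c₂ := Finset.card_filter_add_card_filter_not (s := A) (fun e => e ∈ T')
  omega

/-- A tour of a tree faces every edge, so the tours of different trees diverge somewhere; either
tree may own the edge faced there. -/
lemma tourDivisor_injective (hT : IsSpanningTree G T) (hT' : IsSpanningTree G T') (d : Dart G)
    (h : tourDivisor R d T = tourDivisor R d T') : T = T' := by
  classical
  by_contra hne
  have hex : ∃ n, ¬ (((tourStep R T)^[n] d).edge ∈ T ↔ ((tourStep R T)^[n] d).edge ∈ T') := by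
    by_contra! hall
    refine hne (Set.ext fun e => ?_)
    have := hall (meetTime R T d e)
    rwa [← meetDart, hT.edge_meetDart] at this
  have hn : ∀ j < Nat.find hex,
      (((tourStep R T)^[j] d).edge ∈ T ↔ ((tourStep R T)^[j] d).edge ∈ T') :=
    fun j hj => not_not.1 (Nat.find_min hex hj)
  have hcongr : ∀ j ≤ Nat.find hex, (tourStep R T')^[j] d = (tourStep R T)^[j] d :=
    fun j hj => iterate_congr hn hj
  by_cases hm : ((tourStep R T)^[Nat.find hex] d).edge ∈ T
  · exact hT.tourDivisor_ne hT' hn hm (fun hm' => Nat.find_spec hex (iff_of_true hm hm')) h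
  · refine hT'.tourDivisor_ne hT (n := Nat.find hex) ?_ ?_ ?_ h.symm
    · intro j hj
      rw [hcongr j hj.le]
      exact (hn j hj).symm
    · rw [hcongr _ le_rfl]
      by_contra hm'
      exact Nat.find_spec hex (iff_of_false hm hm')
    · rwa [hcongr _ le_rfl]

end Injective

/-! ### Surjectivity of the Bernardi map -/

section Surjective

variable [Fintype E(G)]

/-- The edge `h` leaves the tree and inherits the chip of `f`, which enters it; the transposition of
`f` and `h` matches the two sums. -/
lemma chipSum_exchange {T : Set E(G)} {c : E(G) → V(G)} {f h : E(G)} (hf : f ∉ T) (hh : h ∈ T)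
    {c' : E(G) → V(G)} (hc' : c' h = c f) (hc : ∀ e, e ≠ h → c' e = c e) :
    chipSum (insert f (T \ {h})) c' = chipSum T c := by
  classical
  have hfh : f ≠ h := fun e => hf (e ▸ hh)
  refine Finset.sum_equiv (Equiv.swap f h) ?_ ?_
  · intro e
    by_cases h₁ : e = f
    · simp [h₁, hh]
    by_cases h₂ : e = h
    · simp [h₂, hf, hfh.symm]
    · simp [h₁, h₂, Equiv.swap_apply_of_ne_of_ne]
  · intro e he
    by_cases h₁ : e = f
    · simp [h₁] at he
    by_cases h₂ : e = h
    · simp [h₂, hc']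
    · rw [Equiv.swap_apply_of_ne_of_ne h₁ h₂, hc _ h₂]

open Classical in
/-- The record of a tour of `T` from `d`: whether the edge faced belongs to `T`, and if not,
whether its chip lies at the current vertex. -/
noncomputable def tourWord (R : RibbonStructure G) (d : Dart G) (T : Set E(G))
    (c : E(G) → V(G)) (i : ℕ) : ℕ :=
  if ((tourStep R T)^[i] d).edge ∈ T then 1
  else if c ((tourStep R T)^[i] d).edge = ((tourStep R T)^[i] d).vertex then 2 else 0

section TourWord

omit [Fintype E(G)]

variable {R : RibbonStructure G} {d a : Dart G} {T : Set E(G)} {c : E(G) → V(G)} {i : ℕ}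
  (hi : (tourStep R T)^[i] d = a)
include hi

lemma tourWord_of_mem (h : a.edge ∈ T) : tourWord R d T c i = 1 := by
  simp [tourWord, hi, h]

lemma tourWord_of_eq (h : a.edge ∉ T) (hc : c a.edge = a.vertex) : tourWord R d T c i = 2 := by
  simp [tourWord, hi, h, hc]

lemma tourWord_of_ne (h : a.edge ∉ T) (hc : c a.edge ≠ a.vertex) : tourWord R d T c i = 0 := by
  simp [tourWord, hi, h, hc]

end TourWord

variable [Fintype V(G)] (R : RibbonStructure G)

/-- Take a representation with maximal record. If the chip of some `f` outside `T` is at the wrong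
end, exchange `f` for the last tree edge `b` on the path to that chip and hand the chip to `b`. The
record is unchanged until `f` or `b` is met, and there it rises: from 0 to 1 if `f` comes first,
from 1 to 2 if `b` does. -/
lemma exists_tourDivisor_eq [G.Loopless] (d : Dart G) {T₀ : Set E(G)} (hT₀ : IsSpanningTree G T₀)
    {c₀ : E(G) → V(G)} (hc₀ : ∀ e : E(G), G.Inc e (c₀ e)) :
    ∃ T, IsSpanningTree G T ∧ tourDivisor R d T = chipSum T₀ c₀ := by
  classical
  let P := {p : Set E(G) × (E(G) → V(G)) // IsSpanningTree G p.1 ∧ (∀ e : E(G), G.Inc e (p.2 e)) ∧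
    chipSum p.1 p.2 = chipSum T₀ c₀}
  have : Nonempty P := ⟨⟨(T₀, c₀), hT₀, hc₀, rfl⟩⟩
  obtain ⟨⟨⟨T, c⟩, hT, hc, hsum⟩, hmax⟩ :=
    Finite.exists_max fun p : P => toLex (tourWord R d p.1.1 p.1.2)
  simp only at hT hc hsum
  refine ⟨T, hT, ?_⟩
  rw [← hsum]
  refine Finset.sum_congr rfl fun f hf => ?_
  replace hf : f ∉ T := by simpa using hf
  congr 1
  by_contra hne
  set a := meetDart R T d f with ha
  replace hne : a.vertex ≠ c f := hne
  have haf : a.edge = f := hT.edge_meetDart _ _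
  have hcf : c f = a.opp.vertex := by
    have hi := hc f
    rw [← haf] at hi
    rcases hi.eq_or_eq_of_isLink a.isLink with h | h
    · exact absurd (Subtype.ext (haf ▸ h.symm)) hne
    · exact Subtype.ext (haf ▸ h)
  obtain ⟨b, hbT, hb, hab⟩ := (hT.joined a.vertex a.opp.vertex).exists_last a.vertex_opp_ne.symm
  have hfb : f ≠ b.edge := fun e => hf (e ▸ hbT)
  have htree : IsSpanningTree G (insert f (T \ {b.edge})) := by
    have := hT.exchange (a := b.opp) (d := a) hbT (haf ▸ hf) hab.symm
      (by rw [Dart.opp_opp, hb]; exact .refl _)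
    rwa [haf] at this
  set c' := Function.update c b.edge b.vertex with hc'
  have hc'_ne : ∀ e, e ≠ b.edge → c' e = c e := fun e he => Function.update_of_ne he _ _
  have hc'b : c' b.edge = b.vertex := Function.update_self _ _ _
  have hinc : ∀ e : E(G), G.Inc e (c' e) := by
    intro e
    by_cases he : e = b.edge
    · rw [he, hc'b]
      exact b.inc
    · rw [hc'_ne _ he]
      exact hc e
  have hle := hmax ⟨(insert f (T \ {b.edge}), c'), htree, hinc, by
    rw [← hsum]
    exact chipSum_exchange hf hbT (by simp only [hc'b, hb, hcf]) hc'_ne⟩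
  refine not_lt_of_ge hle ?_
  have hmem : ∀ e, e ≠ f → e ≠ b.edge → (e ∈ T ↔ e ∈ insert f (T \ {b.edge})) := by
    intro e h₁ h₂
    simp [h₁, h₂]
  have hword : ∀ n, (∀ j < n, ((tourStep R T)^[j] d).edge ≠ f ∧
      ((tourStep R T)^[j] d).edge ≠ b.edge) →
      (∀ j ≤ n, (tourStep R (insert f (T \ {b.edge})))^[j] d = (tourStep R T)^[j] d) ∧
      ∀ j < n, tourWord R d T c j = tourWord R d (insert f (T \ {b.edge})) c' j := by
    intro n hn
    have hcongr : ∀ j ≤ n, (tourStep R (insert f (T \ {b.edge})))^[j] d = (tourStep R T)^[j] d :=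
      fun j hj => iterate_congr (fun i hi => hmem _ (hn i hi).1 (hn i hi).2) hj
    refine ⟨hcongr, fun j hj => ?_⟩
    have hiff := hmem _ (hn j hj).1 (hn j hj).2
    have hc'j := hc'_ne _ (hn j hj).2
    by_cases h₁ : ((tourStep R T)^[j] d).edge ∈ T
    · rw [tourWord_of_mem rfl h₁, tourWord_of_mem (hcongr j hj.le) (hiff.1 h₁)]
    by_cases h₂ : c ((tourStep R T)^[j] d).edge = ((tourStep R T)^[j] d).vertex
    · rw [tourWord_of_eq rfl h₁ h₂,
        tourWord_of_eq (hcongr j hj.le) (mt hiff.2 h₁) (hc'j.trans h₂)]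
    · rw [tourWord_of_ne rfl h₁ h₂,
        tourWord_of_ne (hcongr j hj.le) (mt hiff.2 h₁) (by rwa [hc'j])]
  rcases lt_trichotomy (meetTime R T d f) (meetTime R T d b.edge) with hlt | heq | hlt
  · obtain ⟨hcongr, hw⟩ := hword (meetTime R T d f) fun j hj =>
      ⟨edge_ne_of_lt_meetTime hj, edge_ne_of_lt_meetTime (hj.trans hlt)⟩
    refine ⟨meetTime R T d f, hw, ?_⟩
    change tourWord R d T c _ < tourWord R d (insert f (T \ {b.edge})) c' _
    rw [tourWord_of_ne (a := a) rfl (haf ▸ hf) (by rw [haf]; exact hne.symm),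
      tourWord_of_mem (a := a) (hcongr _ le_rfl) (by rw [haf]; exact Set.mem_insert _ _)]
    exact one_pos
  · refine absurd ?_ hfb
    rw [← hT.edge_meetDart (R := R) d f, ← hT.edge_meetDart (R := R) d b.edge, meetDart, meetDart,
      heq]
  · obtain ⟨hcongr, hw⟩ := hword (meetTime R T d b.edge) fun j hj =>
      ⟨edge_ne_of_lt_meetTime (hj.trans hlt), edge_ne_of_lt_meetTime hj⟩
    -- Had `b` been met from its other end, the tour would next exhaust the side containing the chip
    -- and so meet `f` there; but `a`, where `f` is met, lies on the other side.
    have hmeet : meetDart R T d b.edge = b := by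
      refine (Dart.eq_or_eq_opp (hT.edge_meetDart (R := R) d b.edge)).resolve_right fun h => ?_
      have := hT.joined_meetDart_of_ge (R := R) (d := d) (z := a.opp) (e := b.edge) hbT
        (by rw [h, Dart.opp_opp, hb]; exact .refl _) (by simpa [haf] using hfb)
        (by simpa [haf] using hlt.le)
      rw [h, Dart.opp_opp, Dart.edge_opp, haf, ← ha] at this
      exact hT.not_joined_diff hbT (this.trans hab)
    refine ⟨meetTime R T d b.edge, hw, ?_⟩
    change tourWord R d T c _ < tourWord R d (insert f (T \ {b.edge})) c' _
    rw [tourWord_of_mem (a := b) hmeet hbT,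
      tourWord_of_eq (a := b) ((hcongr _ le_rfl).trans hmeet) (by simp [hfb.symm]) hc'b]
    exact one_lt_two

end Surjective

/-! ### The Laplacian as a sum over edges -/

section Laplacian

variable [Fintype V(G)] [Fintype E(G)]

/-- Looplessness makes the two halves of an edge distinct. -/
lemma sum_dart [G.Loopless] {M : Type*} [AddCommMonoid M] {o : E(G) → Dart G}
    (ho : ∀ e, (o e).edge = e) (F : Dart G → M) :
    ∑ d, F d = ∑ e, (F (o e) + F (o e).opp) := by
  classical
  rw [← Finset.sum_fiberwise (s := Finset.univ) (g := Dart.edge)]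
  refine Finset.sum_congr rfl fun e _ => ?_
  rw [← Finset.sum_pair (o e).opp_ne.symm]
  refine Finset.sum_congr ?_ fun _ _ => rfl
  ext d
  simp only [Finset.mem_filter, Finset.mem_univ, true_and, Finset.mem_insert,
    Finset.mem_singleton]
  constructor
  · intro h
    exact Dart.eq_or_eq_opp (h.trans (ho e).symm)
  · rintro (rfl | rfl)
    · exact ho e
    · exact ho e

lemma laplacian_eq_sum [G.Loopless] {o : E(G) → Dart G} (ho : ∀ e, (o e).edge = e)
    (f : V(G) → ℤ) :
    laplacian G f = ∑ e, (f (o e).vertex - f (o e).opp.vertex) •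
      (pointDiv (o e).vertex - pointDiv (o e).opp.vertex) := by
  classical
  ext v
  have h₁ : laplacian G f v =
      ∑ d : Dart G, (f d.vertex - f d.opp.vertex) * pointDiv d.vertex v := by
    change ∑ d : Dart G with d.vertex = v, (f v - f d.opp.vertex) = _
    rw [Finset.sum_filter]
    refine Finset.sum_congr rfl fun d _ => ?_
    by_cases h : d.vertex = v
    · subst h
      simp [pointDiv]
    · simp [pointDiv, h, Ne.symm h]
  rw [h₁, sum_dart ho, Finset.sum_apply]
  refine Finset.sum_congr rfl fun e _ => ?_
  simp only [Dart.opp_opp, Pi.smul_apply, Pi.sub_apply, smul_eq_mul]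
  ring

end Laplacian

/-! ### Turning the initial half-edge -/

section Next

variable [Fintype V(G)] [Fintype E(G)] {R : RibbonStructure G} {T : Set E(G)}

namespace IsSpanningTree

variable (hT : IsSpanningTree G T)
include hT

lemma meetDart_next {d : Dart G} (hd : d.edge ∈ T) {f : E(G)} (hf : f ≠ d.edge) :
    meetDart R T (R.next d) f = meetDart R T d.opp f := by
  rw [← hT.meetDart_iterate (d := d.opp) (n := 1), Function.iterate_one,
    tourStep_of_mem (d := d.opp) hd, Dart.opp_opp]
  intro j hj
  obtain rfl : j = 0 := by omega
  exact hf.symm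

/-- From `d` the tour makes an excursion to the far side that ends at `d.opp`; an edge with both
ends on the near side is not met during it. -/
lemma meetDart_opp {d z : Dart G} (hd : d.edge ∈ T) (hz : z.edge ≠ d.edge)
    (h₁ : Joined G (T \ {d.edge}) d.vertex z.vertex)
    (h₂ : Joined G (T \ {d.edge}) d.vertex z.opp.vertex) :
    meetDart R T d.opp z.edge = meetDart R T d z.edge := by
  obtain ⟨k, hk, hkd, hkj⟩ := hT.exists_iterate_side (R := R) (d := d.opp) (z := d.opp) hd (.refl _)
  rw [Dart.opp_opp] at hkd hkj
  have h : meetDart R T ((tourStep R T)^[k + 1] d) z.edge = meetDart R T d z.edge := by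
    refine hT.meetDart_iterate fun j hj hje => ?_
    rcases Nat.eq_zero_or_pos j with rfl | hj0
    · exact hz hje.symm
    · have hfar := hkj j hj0 (by omega)
      rw [Dart.edge_opp, hT.joined_diff_opp_iff hd] at hfar
      rcases Dart.eq_or_eq_opp hje with h | h <;> rw [h] at hfar
      · exact hfar h₁
      · exact hfar h₂
  rw [← h, Function.iterate_succ_apply', hkd, tourStep_of_mem (d := d.opp) hd, Dart.opp_opp,
    hT.meetDart_next hd hz]

/-- The new tour is the old one without its first step, so only the chip of the edge of `d` can
move. The tour comes back to `d` only after passing all other half-edges, so that edge is now met at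
`d.opp`. -/
lemma tourDivisor_next_of_notMem [G.Loopless] {d : Dart G} (hd : d.edge ∉ T) :
    tourDivisor R (R.next d) T =
      tourDivisor R d T + (pointDiv d.opp.vertex - pointDiv d.vertex) := by
  classical
  have hstep : tourStep R T d = R.next d := tourStep_of_notMem hd
  have hd₁ : meetDart R T d d.edge = d := meetDart_eq (k := 0) rfl rfl (by simp)
  have hd₂ : meetDart R T (R.next d) d.edge = d.opp := by
    obtain ⟨k, hk, hmin⟩ : ∃ k, (tourStep R T)^[k] (R.next d) = d.opp ∧
        ∀ j < k, (tourStep R T)^[j] (R.next d) ≠ d.opp := by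
      have hex := hT.exists_iterate (R := R) (R.next d) d.opp
      exact ⟨Nat.find hex, Nat.find_spec hex, fun j hj => Nat.find_min hex hj⟩
    refine meetDart_eq hk rfl fun j hj hje => ?_
    rcases Dart.eq_or_eq_opp hje with h | h
    · refine hmin (k - (j + 1)) (by omega) ?_
      rw [← hk]
      nth_rw 2 [show k = k - (j + 1) + (j + 1) by omega]
      rw [Function.iterate_add_apply, Function.iterate_succ_apply', h, hstep]
    · exact hmin j hj h
  rw [← sub_eq_iff_eq_add', tourDivisor, tourDivisor, chipSum, chipSum, ← Finset.sum_sub_distrib,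
    Finset.sum_eq_single_of_mem d.edge (by simpa)]
  · simp only [hd₁, hd₂]
  · intro f _ hf
    have : meetDart R T (R.next d) f = meetDart R T d f := by
      rw [← hstep]
      refine hT.meetDart_iterate (n := 1) fun j hj => ?_
      obtain rfl : j = 0 := by omega
      exact hf.symm
    rw [this, sub_self]

/-- Turning `d` swaps the order in which the two sides of its edge are visited, so each other edge
across the cut moves its chip from the far end to the near end. Subtracting the Laplacian of the
indicator `s` of the far side does this for all cut edges, the edge of `d` included; the term (y) -
(x) compensates for the latter. -/
lemma tourDivisor_next_of_mem [G.Loopless] {d : Dart G} (hd : d.edge ∈ T) :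
    ∃ s, tourDivisor R (R.next d) T =
      tourDivisor R d T + (pointDiv d.opp.vertex - pointDiv d.vertex) - laplacian G s := by
  classical
  set s : V(G) → ℤ := fun u => if Joined G (T \ {d.edge}) d.opp.vertex u then 1 else 0 with hs
  have hs₁ : ∀ {u}, Joined G (T \ {d.edge}) d.opp.vertex u → s u = 1 := fun h => if_pos h
  have hs₀ : ∀ {u}, Joined G (T \ {d.edge}) d.vertex u → s u = 0 := fun h =>
    if_neg fun h' => (hT.joined_diff_opp_iff hd _).1 h' h
  have hd₁ : meetDart R T d d.edge = d := meetDart_eq (k := 0) rfl rfl (by simp)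
  have hd₂ : meetDart R T d.opp d.edge = d.opp := meetDart_eq (k := 0) rfl rfl (by simp)
  set K : E(G) → V(G) → ℤ := fun e =>
    (s (meetDart R T d e).vertex - s (meetDart R T d e).opp.vertex) •
      (pointDiv (meetDart R T d e).vertex - pointDiv (meetDart R T d e).opp.vertex) with hK
  -- Each edge is directed away from the end at which the tour from `d` meets it.
  have hlap : laplacian G s = ∑ e, K e := laplacian_eq_sum (fun e => hT.edge_meetDart d e) s
  have hKd : K d.edge = pointDiv d.opp.vertex - pointDiv d.vertex := by
    simp only [hK, hd₁, hs₁ (.refl _), hs₀ (.refl _)]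
    module
  have hKT : ∑ e with e ∈ T, K e = pointDiv d.opp.vertex - pointDiv d.vertex := by
    rw [← hKd]
    refine Finset.sum_eq_single_of_mem _ (by simpa) fun e he hne => ?_
    have hst := (meetDart R T d e).joined (T := T \ {d.edge})
      (by rw [hT.edge_meetDart]; exact ⟨by simpa using he, hne⟩)
    have : s (meetDart R T d e).vertex = s (meetDart R T d e).opp.vertex := by
      rcases hT.joined_diff_or hd (meetDart R T d e).vertex with h | h
      · rw [hs₀ h, hs₀ (h.trans hst)]
      · rw [hs₁ h, hs₁ (h.trans hst)]
    simp [hK, this]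
  have hKnT : ∑ e with e ∉ T, K e = tourDivisor R d T - tourDivisor R (R.next d) T := by
    rw [tourDivisor, tourDivisor, chipSum, chipSum, ← Finset.sum_sub_distrib]
    refine Finset.sum_congr rfl fun f hf => ?_
    have hfd : f ≠ d.edge := by
      rintro rfl
      simp [hd] at hf
    rw [hT.meetDart_next hd hfd]
    set z := meetDart R T d f with hz
    have hzf : z.edge = f := hT.edge_meetDart _ _
    have hK' : K f = (s z.vertex - s z.opp.vertex) • (pointDiv z.vertex - pointDiv z.opp.vertex) :=
      rfl
    rw [hK']
    -- Edges inside one side keep their chips. An edge across the cut is met first at its far end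
    -- from `d`, which excludes the second case, and at its near end from `d.opp`.
    rcases hT.joined_diff_or hd z.vertex with h₁ | h₁ <;>
      rcases hT.joined_diff_or hd z.opp.vertex with h₂ | h₂
    · have := hT.meetDart_opp (R := R) (z := z) hd (by rwa [hzf]) h₁ h₂
      rw [hzf, ← hz] at this
      rw [hs₀ h₁, hs₀ h₂, this]
      simp
    · exfalso
      have := hT.joined_meetDart_of_ge (R := R) (d := d) (z := z.opp) hd (by rwa [hd₁])
        (by simpa [hzf]) ((meetTime_le (k := 0) rfl).trans (Nat.zero_le _))
      rw [hd₁, Dart.edge_opp, hzf, ← hz, hT.joined_diff_opp_iff hd] at this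
      exact this h₁
    · have hmeet : meetDart R T d.opp f = z.opp := by
        refine (Dart.eq_or_eq_opp ((hT.edge_meetDart _ _).trans hzf.symm)).resolve_left fun h => ?_
        have := hT.joined_meetDart_of_ge (R := R) (d := d.opp) (z := z.opp) hd
          (by rwa [hd₂, Dart.opp_opp]) (by simpa [hzf])
          ((meetTime_le (k := 0) rfl).trans (Nat.zero_le _))
        rw [hd₂, Dart.opp_opp, Dart.edge_opp, hzf, h] at this
        exact (hT.joined_diff_opp_iff hd _).1 h₁ this
      rw [hs₁ h₁, hs₀ h₂, hmeet]
      simp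
    · have := hT.meetDart_opp (R := R) (d := d.opp) (z := z) hd (by rwa [hzf]) h₁ h₂
      rw [hzf, Dart.opp_opp, ← hz] at this
      rw [hs₁ h₁, hs₁ h₂, ← this]
      simp
  refine ⟨s, ?_⟩
  rw [hlap, ← Finset.sum_filter_add_sum_filter_not _ (fun e => e ∈ T), hKT, hKnT]
  abel

/-- Passing to the next initial half-edge translates the class of the tour divisor by an amount
that does not depend on the tree. -/
lemma divClass_tourDivisor_next [G.Loopless] (d : Dart G) :
    divClass G (tourDivisor R (R.next d) T) =
      divClass G (tourDivisor R d T) +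
        divClass G (pointDiv d.opp.vertex - pointDiv d.vertex) := by
  by_cases hd : d.edge ∈ T
  · obtain ⟨s, hs⟩ := hT.tourDivisor_next_of_mem (R := R) hd
    have h0 : divClass G (laplacian G s) = 0 :=
      (QuotientAddGroup.eq_zero_iff _).2 ⟨s, rfl⟩
    rw [hs, map_sub, h0, sub_zero, map_add]
  · rw [hT.tourDivisor_next_of_notMem hd, map_add]

end IsSpanningTree

omit [Fintype E(G)] in
lemma deg_pointDiv (x : V(G)) : deg G (pointDiv x) = 1 := by
  classical
  change ∑ y, pointDiv x y = 1
  simp [pointDiv]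

lemma exists_divClass_tourDivisor [G.Loopless] (d d' : Dart G) (h : d.vertex = d'.vertex) :
    ∃ γ : PicZero G, ∀ T, IsSpanningTree G T →
      divClass G (tourDivisor R d' T) = γ + divClass G (tourDivisor R d T) := by
  obtain ⟨n, rfl⟩ := (R.sameCycle d d' h).exists_nat_pow_eq
  clear h
  induction n with
  | zero => exact ⟨0, fun T _ => by simp⟩
  | succ n ih =>
    obtain ⟨γ, hγ⟩ := ih
    rw [pow_succ', Equiv.Perm.mul_apply]
    set a := (R.next ^ n) d
    have hmem : divClass G (pointDiv a.opp.vertex - pointDiv a.vertex) ∈ PicZero G := by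
      refine ⟨_, ?_, rfl⟩
      change deg G _ = 0
      rw [map_sub, deg_pointDiv, deg_pointDiv, sub_self]
    refine ⟨γ + ⟨_, hmem⟩, fun T hT => ?_⟩
    rw [hT.divClass_tourDivisor_next, hγ T hT, AddSubgroup.coe_add]
    abel

end Next

end Bernardi

namespace Bernardi

variable {α β : Type*} {G : Graph α β} [Fintype V(G)] [Fintype E(G)]

/-! ### Break divisors -/

/-- `D` is a break divisor. -/
def IsBreakDivisor (D : V(G) → ℤ) : Prop := ∃ T, IsSpanningTree G T ∧ IsBreakDivisorOf G T D

omit [Fintype V(G)] in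
lemma isBreakDivisorOf_chipSum (T : Set E(G)) {c : E(G) → V(G)} (hc : ∀ e : E(G), G.Inc e (c e)) :
    IsBreakDivisorOf G T (chipSum T c) := by
  classical
  refine ⟨fun e => c e, fun e => hc e, ?_⟩
  rw [chipSum_eq_sum_subtype]

omit [Fintype V(G)] in
lemma IsBreakDivisorOf.exists_chipSum {T : Set E(G)} {D : V(G) → ℤ}
    (h : IsBreakDivisorOf G T D) :
    ∃ c : E(G) → V(G), (∀ e : E(G), G.Inc e (c e)) ∧ D = chipSum T c := by
  classical
  obtain ⟨c, hc, rfl⟩ := h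
  have : ∀ e : E(G), ∃ x : V(G), G.Inc e x := fun e => by
    obtain ⟨d, rfl⟩ := Dart.exists_edge e
    exact ⟨_, d.inc⟩
  choose c₀ hc₀ using this
  refine ⟨fun e => if h : e ∉ T then c ⟨e, h⟩ else c₀ e, fun e => ?_, ?_⟩
  · by_cases h : e ∉ T
    · simp only [dif_pos h]
      exact hc ⟨e, h⟩
    · simp only [dif_neg h]
      exact hc₀ e
  · rw [chipSum_eq_sum_subtype]
    refine Eq.trans ?_ (Finset.sum_congr rfl fun e _ => congrArg pointDiv (dif_pos e.2).symm)
    rfl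

lemma IsSpanningTree.isBreakDivisor_tourDivisor {T : Set E(G)} (hT : IsSpanningTree G T)
    (R : RibbonStructure G) (d : Dart G) : IsBreakDivisor (tourDivisor R d T) := by
  refine ⟨T, hT, isBreakDivisorOf_chipSum T fun e => ?_⟩
  have := (meetDart R T d e).inc
  rwa [hT.edge_meetDart] at this

lemma IsBreakDivisor.exists_tourDivisor [G.Loopless] {D : V(G) → ℤ} (hD : IsBreakDivisor D)
    (R : RibbonStructure G) (d : Dart G) : ∃ T, IsSpanningTree G T ∧ tourDivisor R d T = D := by
  obtain ⟨T₀, hT₀, h⟩ := hD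
  obtain ⟨c, hc, rfl⟩ := h.exists_chipSum
  exact exists_tourDivisor_eq R d hT₀ hc

lemma IsBreakDivisor.deg_eq {D : V(G) → ℤ} (hD : IsBreakDivisor D) (q : V(G)) :
    deg G D = genus G := by
  classical
  obtain ⟨T, hT, h⟩ := hD
  obtain ⟨c, hc, rfl⟩ := h.exists_chipSum
  change ∑ u, chipSum T c u = _
  rw [sum_chipSum, genus]
  have h₁ := hT.card_add_one q
  have h₂ := Finset.card_filter_add_card_filter_not (s := (Finset.univ : Finset E(G)))
    (fun e => e ∈ T)
  rw [Finset.card_univ] at h₂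
  simp only [Finset.mem_univ, and_true]
  omega

/-! ### Linearly equivalent break divisors are equal -/

open Classical in
/-- The set of edges incident to a set of vertices. -/
noncomputable def incEdges (S : Finset V(G)) : Finset E(G) :=
  Finset.univ.filter fun e => ∃ u ∈ S, G.Inc e u

omit [Fintype V(G)] in
lemma mem_incEdges {S : Finset V(G)} {e : E(G)} : e ∈ incEdges S ↔ ∃ u ∈ S, G.Inc e u := by
  simp [incEdges]

omit [Fintype V(G)] in
-- The chips on `S` come from edges at `S` outside the tree, and the tree itself uses at least #S
-- edges at `S`.
lemma IsBreakDivisor.sum_add_card_le {D : V(G) → ℤ} (hD : IsBreakDivisor D) {S : Finset V(G)}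
    (hS : ∃ q, q ∉ S) : ∑ u ∈ S, D u + S.card ≤ (incEdges S).card := by
  classical
  obtain ⟨T, hT, h⟩ := hD
  obtain ⟨c, hc, rfl⟩ := h.exists_chipSum
  rw [sum_chipSum]
  have h₁ := hT.card_le_card_inc S hS
  have h₂ := Finset.card_filter_add_card_filter_not (s := incEdges S) (fun e => e ∈ T)
  have h₃ : (Finset.univ.filter fun e => e ∈ T ∧ ∃ u ∈ S, G.Inc e u).card ≤
      ((incEdges S).filter fun e => e ∈ T).card := by
    refine Finset.card_le_card fun e he => ?_
    simp only [Finset.mem_filter, Finset.mem_univ, true_and, mem_incEdges] at he ⊢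
    exact he.symm
  have h₄ : (Finset.univ.filter fun e => e ∉ T ∧ c e ∈ S).card ≤
      ((incEdges S).filter fun e => e ∉ T).card := by
    refine Finset.card_le_card fun e he => ?_
    simp only [Finset.mem_filter, Finset.mem_univ, true_and, mem_incEdges] at he ⊢
    exact ⟨⟨_, he.2, hc e⟩, he.1⟩
  omega

open Classical in
/-- Where `f` is maximal, its Laplacian is at least the number of edges to lower levels. -/
lemma card_le_sum_laplacian (f : V(G) → ℤ) {M : ℤ} (hM : ∀ u, f u ≤ M) :
    ((incEdges (Finset.univ.filter fun u => f u = M) ∩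
      incEdges (Finset.univ.filter fun u => f u = M)ᶜ).card : ℤ) ≤
      ∑ u with f u = M, laplacian G f u := by
  have h₁ : ∑ u with f u = M, laplacian G f u =
      ∑ d : Dart G, if f d.vertex = M then f d.vertex - f d.opp.vertex else 0 := by
    have : ∀ u, laplacian G f u = ∑ d : Dart G with d.vertex = u, (f u - f d.opp.vertex) :=
      fun u => rfl
    rw [← Finset.sum_fiberwise (s := Finset.univ) (g := Dart.vertex), Finset.sum_filter]
    refine Finset.sum_congr rfl fun u _ => ?_
    split_ifs with hu
    · rw [this]
      refine Finset.sum_congr rfl fun d hd => ?_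
      obtain rfl : d.vertex = u := by simpa using hd
      rw [if_pos hu]
    · refine (Finset.sum_eq_zero fun d hd => ?_).symm
      obtain rfl : d.vertex = u := by simpa using hd
      rw [if_neg hu]
  have h₂ : (incEdges (Finset.univ.filter fun u => f u = M) ∩
      incEdges (Finset.univ.filter fun u => f u = M)ᶜ).card ≤
      (Finset.univ.filter fun d : Dart G => f d.vertex = M ∧ f d.opp.vertex ≠ M).card := by
    refine Finset.card_le_card_of_surjOn Dart.edge fun e he => ?_
    simp only [Finset.coe_inter, Set.mem_inter_iff, Finset.mem_coe, mem_incEdges,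
      Finset.mem_compl, Finset.mem_filter, Finset.mem_univ, true_and] at he
    obtain ⟨⟨u, hu, hinc⟩, w, hw, hinc'⟩ := he
    obtain ⟨d, rfl, rfl⟩ := Dart.exists_of_inc hinc
    refine ⟨d, ?_, rfl⟩
    rcases hinc'.eq_or_eq_of_isLink d.isLink with h | h
    · exact absurd (Subtype.ext h ▸ hu) hw
    · simp only [Finset.coe_filter, Finset.mem_univ, true_and, Set.mem_ofPred_eq]
      exact ⟨hu, Subtype.ext h ▸ hw⟩
  rw [h₁]
  refine (Nat.cast_le.2 h₂).trans ?_
  rw [Finset.card_filter]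
  push_cast
  refine Finset.sum_le_sum fun d _ => ?_
  have := hM d.opp.vertex
  split_ifs with ha hb <;> first | exact absurd ha.1 hb | omega

/-- Let Δf = D - D' with `f` not constant, and let `S` be the set where `f` is maximal. Then D(S) -
D'(S) is at least the number of edges leaving `S`. The bounds of `sum_add_card_le` for D on `S` and
for D' on its complement, with deg D' = g, make it strictly smaller. -/
lemma IsBreakDivisor.eq_of_divClass_eq {D D' : V(G) → ℤ} (hD : IsBreakDivisor D)
    (hD' : IsBreakDivisor D') (h : divClass G D = divClass G D') : D = D' := by
  classical
  rcases isEmpty_or_nonempty V(G) with hV | hV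
  · exact Subsingleton.elim _ _
  obtain ⟨f, hf⟩ : ∃ f, laplacian G f = -D' + D := QuotientAddGroup.eq.1 h.symm
  obtain ⟨m, hm⟩ := Finite.exists_max f
  by_cases hconst : ∀ u, f u = f m
  · have : laplacian G f = 0 := by
      ext u
      change ∑ d : Dart G with d.vertex = u, (f u - f d.opp.vertex) = 0
      exact Finset.sum_eq_zero fun d _ => by rw [hconst u, hconst d.opp.vertex, sub_self]
    rw [this] at hf
    exact (neg_add_eq_zero.1 hf.symm).symm
  · exfalso
    push Not at hconst
    obtain ⟨w, hw⟩ := hconst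
    set S := Finset.univ.filter fun u => f u = f m with hS
    have h₁ := card_le_sum_laplacian (G := G) f hm
    rw [← hS, hf] at h₁
    simp only [Pi.add_apply, Pi.neg_apply, Finset.sum_add_distrib, Finset.sum_neg_distrib] at h₁
    have h₂ := hD.sum_add_card_le (S := S) ⟨w, by simpa [hS] using hw⟩
    have h₃ := hD'.sum_add_card_le (S := Sᶜ) ⟨m, by simp [hS]⟩
    have h₄ : ∑ u ∈ S, D' u + ∑ u ∈ Sᶜ, D' u = genus G := by
      rw [Finset.sum_add_sum_compl]
      exact hD'.deg_eq m
    have h₅ := Finset.card_union_add_card_inter (incEdges S) (incEdges Sᶜ)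
    have h₆ : incEdges S ∪ incEdges Sᶜ = Finset.univ := by
      refine Finset.eq_univ_of_forall fun e => ?_
      obtain ⟨d, rfl⟩ := Dart.exists_edge e
      rw [Finset.mem_union, mem_incEdges, mem_incEdges]
      by_cases hd : d.vertex ∈ S
      · exact .inl ⟨_, hd, d.inc⟩
      · exact .inr ⟨_, Finset.mem_compl.2 hd, d.inc⟩
    rw [h₆, Finset.card_univ] at h₅
    have h₇ := Finset.card_add_card_compl S
    rw [genus] at h₄
    omega

/-! ### Every class of degree `g` contains a break divisor -/

/-- The divisors whose classes carry the set of classes of break divisors into itself. -/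
def breakTranslations (G : Graph α β) [Fintype V(G)] [Fintype E(G)] :
    AddSubmonoid (V(G) → ℤ) where
  carrier := {c | ∀ D, IsBreakDivisor D →
    ∃ D', IsBreakDivisor D' ∧ divClass G D' = divClass G D + divClass G c}
  zero_mem' := fun D hD => ⟨D, hD, by simp⟩
  add_mem' := by
    intro a b ha hb D hD
    obtain ⟨D₁, h₁, e₁⟩ := ha D hD
    obtain ⟨D₂, h₂, e₂⟩ := hb D₁ h₁
    exact ⟨D₂, h₂, by rw [e₂, e₁, map_add, add_assoc]⟩

/-- For adjacent vertices, write the break divisor as β_d(T) with `d` the half-edge leading from one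
to the other, then turn `d`. This is why the surjectivity of the Bernardi map is needed here. -/
lemma pointDiv_sub_mem_breakTranslations [G.Loopless] (R : RibbonStructure G) {T : Set E(G)}
    {x y : V(G)} (h : Joined G T x y) : pointDiv y - pointDiv x ∈ breakTranslations G := by
  refine h.induction (P := fun y => pointDiv y - pointDiv x ∈ breakTranslations G) ?_ ?_
  · rw [sub_self]
    exact zero_mem _
  · intro d _ _ ih
    have hd : pointDiv d.opp.vertex - pointDiv d.vertex ∈ breakTranslations G := by
      intro D hD
      obtain ⟨T, hT, rfl⟩ := hD.exists_tourDivisor R d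
      exact ⟨_, hT.isBreakDivisor_tourDivisor R (R.next d), hT.divClass_tourDivisor_next d⟩
    have := add_mem hd ih
    rwa [sub_add_sub_cancel] at this

lemma mem_breakTranslations [G.Loopless] (hG : IsConnected G) (R : RibbonStructure G)
    {D : V(G) → ℤ} (hD : deg G D = 0) : D ∈ breakTranslations G := by
  classical
  obtain ⟨q⟩ := hG.1
  have hsum : D = ∑ x, D x • (pointDiv x - pointDiv q) := by
    have h₁ : ∑ x, D x • pointDiv x = D := by
      ext u
      simp [pointDiv, Finset.sum_apply, Pi.single_apply]
    have h₂ : ∑ x, D x = 0 := hD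
    simp only [smul_sub, Finset.sum_sub_distrib, ← Finset.sum_smul, h₁, h₂, zero_smul, sub_zero]
  rw [hsum]
  refine sum_mem fun x _ => ?_
  -- The translations are only known to form a submonoid, so a negative coefficient is handled by
  -- the walk in the opposite direction.
  obtain ⟨n, hn | hn⟩ := Int.eq_nat_or_neg (D x)
  · rw [hn, natCast_zsmul]
    exact nsmul_mem (pointDiv_sub_mem_breakTranslations R (hG.2 q x)) n
  · rw [hn, neg_smul, ← smul_neg, neg_sub, natCast_zsmul]
    exact nsmul_mem (pointDiv_sub_mem_breakTranslations R (hG.2 x q)) n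

omit [Fintype V(G)] in
lemma IsConnected.exists_isBreakDivisor (hG : IsConnected G) :
    ∃ D : V(G) → ℤ, IsBreakDivisor D := by
  obtain ⟨T, hT⟩ := hG.exists_isSpanningTree
  have : ∀ e : E(G), ∃ x : V(G), G.Inc e x := fun e => by
    obtain ⟨d, rfl⟩ := Dart.exists_edge e
    exact ⟨_, d.inc⟩
  choose c hc using this
  exact ⟨_, T, hT, isBreakDivisorOf_chipSum T hc⟩

lemma exists_isBreakDivisor_divClass_eq [G.Loopless] (hG : IsConnected G) (R : RibbonStructure G)
    {D : V(G) → ℤ} (hD : deg G D = genus G) :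
    ∃ D', IsBreakDivisor D' ∧ divClass G D' = divClass G D := by
  obtain ⟨D₀, h₀⟩ := hG.exists_isBreakDivisor
  obtain ⟨q⟩ := hG.1
  obtain ⟨D', h', e'⟩ := mem_breakTranslations hG R (D := D - D₀)
    (by rw [map_sub, hD, h₀.deg_eq q, sub_self]) D₀ h₀
  exact ⟨D', h', by rw [e', map_sub, add_sub_cancel]⟩

/-! ### The bijections -/

/-- The bijection from break divisors to divisor classes of degree `g`. -/
noncomputable def breakEquiv [G.Loopless] (hG : IsConnected G) (R : RibbonStructure G) :
    BreakDivisor G ≃ PicDeg G (genus G) :=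
  Equiv.ofBijective
    (fun D => ⟨divClass G D.1, D.1, IsBreakDivisor.deg_eq D.2 hG.1.some, rfl⟩) <| by
    constructor
    · intro D D' h
      exact Subtype.ext (IsBreakDivisor.eq_of_divClass_eq D.2 D'.2 (congrArg Subtype.val h))
    · rintro ⟨_, D, hD, rfl⟩
      obtain ⟨D', h', e'⟩ := exists_isBreakDivisor_divClass_eq hG R hD
      exact ⟨⟨D', h'⟩, Subtype.ext e'⟩

/-- The Bernardi bijection from spanning trees to break divisors. -/
noncomputable def bernardiEquiv [G.Loopless] (R : RibbonStructure G) (d : Dart G) :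
    SpanningTree G ≃ BreakDivisor G :=
  Equiv.ofBijective (fun T => ⟨tourDivisor R d T.1, T.2.isBreakDivisor_tourDivisor R d⟩) <| by
    constructor
    · intro T T' h
      exact Subtype.ext (tourDivisor_injective T.2 T'.2 d (congrArg Subtype.val h))
    · rintro ⟨D, hD⟩
      obtain ⟨T, hT, e⟩ := IsBreakDivisor.exists_tourDivisor hD R d
      exact ⟨⟨T, hT⟩, Subtype.ext e⟩

/-- A nonempty type that is equivalent to `Pic^d(G)` is a torsor for `Pic⁰(G)`. -/
lemma exists_addTorsor {S : Type*} [Nonempty S] {d : ℤ} (φ : S ≃ PicDeg G d) :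
    ∃ _ : AddTorsor (PicZero G) S, ∀ (γ : PicZero G) (s : S), γ +ᵥ s = φ.symm (γ +ᵥ φ s) := by
  have hsub : ∀ c c' : PicDeg G d, c.1 - c'.1 ∈ PicZero G := by
    rintro ⟨_, D, hD, rfl⟩ ⟨_, D', hD', rfl⟩
    refine ⟨D - D', ?_, map_sub _ _ _⟩
    change deg G (D - D') = 0
    rw [map_sub, hD, hD', sub_self]
  exact ⟨{
    vadd := fun γ s => φ.symm (γ +ᵥ φ s)
    zero_vadd := fun s => by
      change φ.symm ((0 : PicZero G) +ᵥ φ s) = s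
      simp
    add_vadd := fun γ γ' s => by
      change φ.symm ((γ + γ') +ᵥ φ s) = φ.symm (γ +ᵥ φ (φ.symm (γ' +ᵥ φ s)))
      rw [Equiv.apply_symm_apply, add_vadd]
    vsub := fun s s' => ⟨(φ s).1 - (φ s').1, hsub _ _⟩
    vsub_vadd' := fun s s' => by
      change φ.symm ((⟨(φ s).1 - (φ s').1, hsub _ _⟩ : PicZero G) +ᵥ φ s') = s
      rw [Equiv.symm_apply_eq]
      exact Subtype.ext (sub_add_cancel _ _)
    vadd_vsub' := fun γ s => by
      refine Subtype.ext ?_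
      change (φ (φ.symm (γ +ᵥ φ s))).1 - (φ s).1 = γ.1
      rw [Equiv.apply_symm_apply]
      exact add_sub_cancel_right _ _ }, fun γ s => rfl⟩

/-! ### The graph with a single vertex -/

omit [Fintype V(G)] [Fintype E(G)] in
lemma isEmpty_edges [G.Loopless] (hG : IsConnected G) {v : V(G)} (hv : IsEmpty (EdgeAt G v)) :
    IsEmpty E(G) := by
  refine ⟨fun e => ?_⟩
  obtain ⟨d, rfl⟩ := Dart.exists_edge e
  have : d.vertex = v := (hG.2 v d.vertex).induction (P := fun z => z = v) rfl fun a _ _ ha =>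
    (hv.false ⟨a.edge, ha ▸ a.inc⟩).elim
  exact hv.false ⟨d.edge, this ▸ d.inc⟩

omit [Fintype V(G)] in
-- With no edges, the empty set is the only tree and zero the only break divisor.
lemma nonempty_spanningTree_equiv [G.Loopless] (hG : IsConnected G) (h : IsEmpty E(G)) :
    Nonempty (SpanningTree G ≃ BreakDivisor G) := by
  obtain ⟨T, hT⟩ := hG.exists_isSpanningTree
  obtain ⟨D, hD⟩ := hG.exists_isBreakDivisor
  have : Subsingleton (SpanningTree G) := ⟨fun T T' => Subtype.ext (Subsingleton.elim _ _)⟩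
  have : Subsingleton (BreakDivisor G) := by
    refine ⟨?_⟩
    rintro ⟨_, _, _, _, _, rfl⟩ ⟨_, _, _, _, _, rfl⟩
    simp
  exact ⟨⟨fun _ => ⟨D, hD⟩, fun _ => ⟨T, hT⟩, fun _ => Subsingleton.elim _ _,
    fun _ => Subsingleton.elim _ _⟩⟩

end Bernardi

/-! ### The main theorem -/

theorem theorem4p1 {α β : Type*} (G : Graph α β) [Fintype V(G)] [Fintype E(G)] [G.Loopless]
    (hG : Bernardi.IsConnected G) (R : Bernardi.RibbonStructure G) (v : V(G)) :
    -- `b` is the bijection `D ↦ [D]` from break divisors to `Pic^g(G)`, and `B e` is the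
    -- Bernardi bijection `β_(v,e)` from spanning trees to break divisors
    ∃ (b : Bernardi.BreakDivisor G ≃ Bernardi.PicDeg G (Bernardi.genus G))
      (B : Bernardi.EdgeAt G v → (Bernardi.SpanningTree G ≃ Bernardi.BreakDivisor G)),
      (∀ D, (b D : Bernardi.Pic G) = Bernardi.divClass G D.1) ∧
      (∀ e T, (B e T).1 = Bernardi.bernardiDivisor R v e T.1) ∧
      -- the Bernardi bijections for two edges at `v` differ by a translation
      (∀ e₁ e₂, ∃ γ₀ : Bernardi.PicZero G, ∀ T, B e₂ T = Bernardi.breakAct b γ₀ (B e₁ T)) ∧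
      -- the transported action does not depend on the edge
      (∀ e₁ e₂ γ T, (B e₁).symm (Bernardi.breakAct b γ (B e₁ T)) =
        (B e₂).symm (Bernardi.breakAct b γ (B e₂ T))) ∧
      -- the transported action makes the set of spanning trees a torsor
      ∃ _ : AddTorsor (Bernardi.PicZero G) (Bernardi.SpanningTree G),
        ∀ e γ T, γ +ᵥ T = (B e).symm (Bernardi.breakAct b γ (B e T)) := by
  let b := Bernardi.breakEquiv hG R
  let B : Bernardi.EdgeAt G v → (Bernardi.SpanningTree G ≃ Bernardi.BreakDivisor G) :=
    fun e => Bernardi.bernardiEquiv R ⟨v, e.1, e.2⟩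
  have htrans : ∀ e₁ e₂, ∃ γ₀ : Bernardi.PicZero G,
      ∀ T, B e₂ T = Bernardi.breakAct b γ₀ (B e₁ T) := by
    intro e₁ e₂
    obtain ⟨γ, hγ⟩ := Bernardi.exists_divClass_tourDivisor (R := R) ⟨v, e₁.1, e₁.2⟩
      ⟨v, e₂.1, e₂.2⟩ rfl
    refine ⟨γ, fun T => ?_⟩
    rw [Bernardi.breakAct, Equiv.eq_symm_apply]
    exact Subtype.ext (hγ T.1 T.2)
  have hindep : ∀ e₁ e₂ γ T, (B e₁).symm (Bernardi.breakAct b γ (B e₁ T)) =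
      (B e₂).symm (Bernardi.breakAct b γ (B e₂ T)) := by
    intro e₁ e₂ γ T
    obtain ⟨γ₀, h₀⟩ := htrans e₁ e₂
    rw [Equiv.eq_symm_apply, h₀, h₀, Equiv.apply_symm_apply]
    -- Commutativity of Pic⁰ moves the translation by `γ₀` past that by `γ`.
    simp only [Bernardi.breakAct, Equiv.apply_symm_apply, vadd_vadd, add_comm]
  refine ⟨b, B, fun D => rfl, fun e T => (Bernardi.bernardiDivisor_eq R v e T.1).symm, htrans,
    hindep, ?_⟩
  have : Nonempty (Bernardi.SpanningTree G) := by
    obtain ⟨T, hT⟩ := hG.exists_isSpanningTree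
    exact ⟨⟨T, hT⟩⟩
  rcases isEmpty_or_nonempty (Bernardi.EdgeAt G v) with hv | ⟨⟨e₀⟩⟩
  -- With no edge at `v` any torsor structure will do, since compatibility is vacuous.
  · obtain ⟨φ⟩ := Bernardi.nonempty_spanningTree_equiv hG (Bernardi.isEmpty_edges hG hv)
    obtain ⟨tor, -⟩ := Bernardi.exists_addTorsor (φ.trans b)
    exact ⟨tor, fun e => hv.elim e⟩
  · obtain ⟨tor, htor⟩ := Bernardi.exists_addTorsor ((B e₀).trans b)
    refine ⟨tor, fun e γ T => ?_⟩
    rw [htor, hindep e e₀]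
    rfl
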